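/- Let $N\ge 1$ be an integer and $\Gamma_0(N)=\left\{\begin{pmatrix}a&b\\c&d\end{pmatrix}\in SL_2(\mathbb Z): c\equiv 0 \pmod N\right\}$. For $\gamma=\begin{pmatrix}a&b\\c&d\end{pmatrix}$ put $\mu_\gamma(z,w)=czw+dw+az+b$. Let $z_1,z_2$ be points of the open upper half-plane such that $z_2\neq\gamma z_1$ for all $\gamma\in\Gamma_0(N)$. Then the series $$\Xi_N(z_1,z_2,s)=\frac12\sum_{\gamma\in\Gamma_0(N)}\frac{\overline{\mu_\gamma(z_1,-z_2)}\;\overline{\mu_\gamma(z_1,-\overline{z_2})}}{|\mu_\gamma(z_1,-z_2)|^{2s}\,|\mu_\gamma(z_1,-\overline{z_2})|^{2s}}$$ converges absolutely for every $s\in\mathbb C$ with $\operatorname{Re}(s)>1$, and, as a function of $s$, it can be analytically continued to the point $s=1$ (without a pole there): there are a connected open set $U\subseteq\mathbb C$ containing both the half-plane $\{\operatorname{Re}(s)>1\}$ and the point $1$, and a holomorphic function $F$ on $U$, with $F(s)=\Xi_N(z_1,z_2,s)$ whenever $\operatorname{Re}(s)>1$. -/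

import Mathlib

open scoped MatrixGroups UpperHalfPlane ComplexConjugate

noncomputable section

/-- `μ_γ(z, w) = c z w + d w + a z + b` for `γ = (a b; c d)`. -/
def mu (γ : SL(2, ℤ)) (z w : ℂ) : ℂ :=
  (γ 1 0 : ℂ) * z * w + (γ 1 1 : ℂ) * w + (γ 0 0 : ℂ) * z + (γ 0 1 : ℂ)

/-- The summand attached to `γ` in the Hecke-regularized Cauchy kernel:
the product of the conjugates of `μ_γ(z₁, -z₂)` and `μ_γ(z₁, -conj z₂)`, divided by
`|μ_γ(z₁, -z₂)| ^ (2 s) * |μ_γ(z₁, -conj z₂)| ^ (2 s)`. -/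
def cauchyTerm (γ : SL(2, ℤ)) (z₁ z₂ s : ℂ) : ℂ :=
  (conj (mu γ z₁ (-z₂)) * conj (mu γ z₁ (-conj z₂))) /
    ((‖mu γ z₁ (-z₂)‖ : ℂ) ^ (2 * s) * (‖mu γ z₁ (-conj z₂)‖ : ℂ) ^ (2 * s))

/-- The series `Ξ_N(z₁, z₂, s)`, a sum over all of `Γ₀(N)`. -/
def cauchyKernel (N : ℕ) (z₁ z₂ s : ℂ) : ℂ :=
  (1 / 2) * ∑' γ : CongruenceSubgroup.Gamma0 N, cauchyTerm (γ : SL(2, ℤ)) z₁ z₂ s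

end

/-! Split the group by the lower left entry `c`. If `c = 0`, then `a = d = ±1` and `b` is free, and
the terms are of size `|b| ^ (2 - 4 re s)`, so this part converges past `re s = 1`. If `c ≠ 0`, the
determinant relation gives `c μ_γ(z, -v) = (a - c v)(c z + d) - 1`. Dropping the `1` replaces the
term by `leadTerm`, a power of `|c|` times a function of `a / c` times a function of `d / c`. The
error gains a factor `c ^ (-2)`, which makes the difference summable near `s = 1` as well.

In the sum of leading terms, fix `|c|`: the pairs `(a, d)` are exactly those with `a d ≡ 1` modulo
`c`. Poisson summation in both variables turns the sum over them into Fourier coefficients weighted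
by Kloosterman sums. The zero frequency gives `φ(c) ∫ leadX ∫ leadY`. The others are controlled by
any bound for Kloosterman sums with a power saving; Kloosterman's fourth moment argument gives `d(c)
c ^ (11/12)`, enough for `re s > 95/96` (`exists_norm_unitPairSum_sub_le`).

The zero frequencies sum to `ζ(4s - 3)` times a Dirichlet series holomorphic near `s = 1`, times the
two integrals. The simple pole of zeta at `s = 1` is cancelled because `∫ leadY` is there the
integral of `(x + z) ^ (-2)`, which is zero (`integral_leadY_one`). -/

/-! ### Kloosterman sums and the fourth moment bound. -/

section Kloosterman

open Finset

variable {c : ℕ} [NeZero c]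

/-- The Kloosterman sum `K(m, n; c)`. -/
noncomputable def kloostermanSum (c : ℕ) [NeZero c] (m n : ZMod c) : ℂ :=
  ∑ u : (ZMod c)ˣ, ZMod.stdAddChar (m * (u : ZMod c) + n * ((u⁻¹ : (ZMod c)ˣ) : ZMod c))

lemma kloostermanSum_comm (m n : ZMod c) : kloostermanSum c m n = kloostermanSum c n m := by
  unfold kloostermanSum
  refine Fintype.sum_equiv (Equiv.inv _) _ _ fun u => ?_
  simp [add_comm]

lemma kloostermanSum_mul_unit (m n : ZMod c) (v : (ZMod c)ˣ) :
    kloostermanSum c (m * v) (n * (v⁻¹ : (ZMod c)ˣ)) = kloostermanSum c m n := by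
  unfold kloostermanSum
  refine Fintype.sum_equiv (Equiv.mulLeft v) _ _ fun u => ?_
  simp only [Equiv.coe_mulLeft, mul_inv_rev, Units.val_mul]
  congr 1
  ring

lemma kloostermanSum_zero_zero : kloostermanSum c 0 0 = Nat.totient c := by
  simp [kloostermanSum, ZMod.card_units_eq_totient]

/-- Expand the square; orthogonality in `m` and in `n` keeps only the coincidences. -/
lemma sum_norm_sq_charSum {ι : Type*} [Fintype ι] (a b : ι → ZMod c) :
    ∑ m : ZMod c, ∑ n : ZMod c, ‖∑ i, (ZMod.stdAddChar (m * a i + n * b i) : ℂ)‖ ^ 2 =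
      (c : ℝ) ^ 2 * #{p : ι × ι | a p.1 = a p.2 ∧ b p.1 = b p.2} := by
  have horth (x : ZMod c) :
      ∑ m : ZMod c, (ZMod.stdAddChar (m * x) : ℂ) = if x = 0 then (c : ℂ) else 0 := by
    rw [AddChar.sum_mulShift x (ZMod.isPrimitive_stdAddChar c), ZMod.card]
    split_ifs <;> simp
  have key (m n : ZMod c) :
      ((‖∑ i, (ZMod.stdAddChar (m * a i + n * b i) : ℂ)‖ ^ 2 : ℝ) : ℂ) =
      ∑ p : ι × ι, (ZMod.stdAddChar (m * (a p.1 - a p.2)) : ℂ) *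
        ZMod.stdAddChar (n * (b p.1 - b p.2)) := by
    push_cast
    rw [← Complex.mul_conj', map_sum, Finset.sum_mul_sum, Fintype.sum_prod_type]
    refine Finset.sum_congr rfl fun i _ => Finset.sum_congr rfl fun j _ => ?_
    rw [← AddChar.map_neg_eq_conj, ← AddChar.map_add_eq_mul, ← AddChar.map_add_eq_mul]
    congr 1
    ring
  apply Complex.ofReal_injective
  simp_rw [Complex.ofReal_sum, key]
  rw [Finset.sum_congr rfl fun m _ => Finset.sum_comm, Finset.sum_comm]
  simp_rw [← Finset.mul_sum, horth, ← Finset.sum_mul, horth, sub_eq_zero]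
  rw [Finset.card_filter]
  push_cast
  rw [Finset.mul_sum]
  refine Finset.sum_congr rfl fun p _ => ?_
  by_cases h1 : a p.1 = a p.2 <;> by_cases h2 : b p.1 = b p.2 <;> simp [h1, h2, sq]

lemma card_dvd_val_le {e : ℕ} (he : e ∣ c) : #{p : ZMod c | e ∣ p.val} ≤ c / e := by
  rw [← Finset.card_range (c / e)]
  refine Finset.card_le_card_of_injOn (fun p => p.val / e) (fun p hp => ?_) fun p hp q hq h => ?_
  · simp only [Finset.coe_range, Set.mem_Iio]
    exact Nat.div_lt_div_of_lt_of_dvd he (ZMod.val_lt p)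
  · simp only [Finset.coe_filter, Finset.mem_univ, true_and, Set.mem_ofPred_eq] at hp hq h
    apply ZMod.val_injective c
    rw [← Nat.div_mul_cancel hp, ← Nat.div_mul_cancel hq, h]

/-- Such a `p` is a multiple of some `e ∣ c` with `e ≥ c ^ (1/3)`, and each `e` has at most `c / e ≤
c ^ (2/3)` multiples. -/
lemma card_large_gcd_le :
    (#{p : ZMod c | c ≤ (p.val.gcd c) ^ 3} : ℝ) ≤ #c.divisors * (c : ℝ) ^ (2 / 3 : ℝ) := by
  have hc : (0 : ℝ) < c := by exact_mod_cast NeZero.pos c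
  have hsub : ({p : ZMod c | c ≤ (p.val.gcd c) ^ 3} : Finset (ZMod c)) ⊆
      (c.divisors.filter fun e => c ≤ e ^ 3).biUnion
        fun e => {p : ZMod c | e ∣ p.val} := by
    intro p hp
    simp only [Finset.mem_filter, Finset.mem_univ, true_and, Finset.mem_biUnion] at hp ⊢
    exact ⟨_, ⟨Nat.mem_divisors.2 ⟨Nat.gcd_dvd_right _ _, NeZero.ne c⟩, hp⟩, Nat.gcd_dvd_left _ _⟩
  calc (#{p : ZMod c | c ≤ (p.val.gcd c) ^ 3} : ℝ)
      ≤ ∑ e ∈ c.divisors.filter fun e => c ≤ e ^ 3, (#{p : ZMod c | e ∣ p.val} : ℝ) := by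
        exact_mod_cast (Finset.card_le_card hsub).trans Finset.card_biUnion_le
    _ ≤ ∑ e ∈ c.divisors.filter fun e => c ≤ e ^ 3, (c : ℝ) ^ (2 / 3 : ℝ) := by
        refine Finset.sum_le_sum fun e he => ?_
        obtain ⟨he1, he2⟩ := Finset.mem_filter.1 he
        have hdvd := Nat.dvd_of_mem_divisors he1
        have he0 : (0 : ℝ) < e := by exact_mod_cast Nat.pos_of_mem_divisors he1
        have h1 : (c : ℝ) ^ (1 / 3 : ℝ) ≤ e := by
          have : (c : ℝ) ≤ (e : ℝ) ^ (3 : ℝ) := by exact_mod_cast he2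
          calc (c : ℝ) ^ (1 / 3 : ℝ) ≤ ((e : ℝ) ^ (3 : ℝ)) ^ (1 / 3 : ℝ) := by gcongr
            _ = e := by rw [← Real.rpow_mul he0.le]; norm_num
        calc (#{p : ZMod c | e ∣ p.val} : ℝ) ≤ ((c / e : ℕ) : ℝ) := by
              exact_mod_cast card_dvd_val_le hdvd
          _ = c / e := Nat.cast_div hdvd he0.ne'
          _ ≤ c / (c : ℝ) ^ (1 / 3 : ℝ) := by gcongr
          _ = (c : ℝ) ^ (2 / 3 : ℝ) := by
              rw [div_eq_iff (by positivity), ← Real.rpow_add hc]; norm_num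
    _ ≤ #c.divisors * (c : ℝ) ^ (2 / 3 : ℝ) := by
        rw [Finset.sum_const, nsmul_eq_mul]
        gcongr
        exact Finset.filter_subset _ _

/-- If `c` divides a product of three residues, it divides the product of their gcds with `c`, so
one gcd is at least `c ^ (1/3)`. That factor has few values, and one further free coordinate fixes
the pair. -/
lemma card_prod_eq_zero_le :
    (#{p : ZMod c × ZMod c | p.1 * p.2 * (p.1 + p.2 + 2) = 0} : ℝ) ≤
      3 * #c.divisors * (c : ℝ) ^ (5 / 3 : ℝ) := by
  classical
  have hc : (0 : ℝ) < c := by exact_mod_cast NeZero.pos c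
  set A : Finset (ZMod c) := {p : ZMod c | c ≤ (p.val.gcd c) ^ 3} with hA
  have hsub : ({p : ZMod c × ZMod c | p.1 * p.2 * (p.1 + p.2 + 2) = 0} : Finset _) ⊆
      (A ×ˢ Finset.univ) ∪ (Finset.univ ×ˢ A) ∪
        (A ×ˢ Finset.univ).image fun q : ZMod c × ZMod c => (q.2, q.1 - q.2 - 2) := by
    rintro ⟨p, q⟩ hp
    simp only [Finset.mem_filter, Finset.mem_univ, true_and] at hp
    by_contra hnot
    simp only [Finset.mem_union, Finset.mem_product, Finset.mem_univ, and_true, true_and,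
      Finset.mem_image, not_or, not_exists, not_and, Prod.forall] at hnot
    obtain ⟨⟨h1, h2⟩, h3⟩ := hnot
    have h3 : (p + q + 2) ∉ A := fun h => h3 (p + q + 2) p h (by ext <;> simp; ring)
    simp only [hA, Finset.mem_filter, Finset.mem_univ, true_and, not_le] at h1 h2 h3
    have hdvd : c ∣ p.val * q.val * (p + q + 2).val := by
      rw [← ZMod.natCast_eq_zero_iff]
      push_cast
      simpa using hp
    have hdvd2 : c ∣ p.val.gcd c * q.val.gcd c * (p + q + 2).val.gcd c := by
      rw [Nat.gcd_comm p.val, Nat.gcd_comm q.val, Nat.gcd_comm (p + q + 2).val]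
      exact (Nat.dvd_gcd dvd_rfl hdvd).trans ((Nat.gcd_mul_right_dvd_mul_gcd c _ _).trans
        (Nat.mul_dvd_mul_right (Nat.gcd_mul_right_dvd_mul_gcd c _ _) _))
    have hpos : 0 < p.val.gcd c * q.val.gcd c * (p + q + 2).val.gcd c := by
      have := fun k : ℕ => Nat.gcd_pos_of_pos_right k (NeZero.pos c)
      have a1 := this p.val
      have a2 := this q.val
      have a3 := this (p + q + 2).val
      positivity
    have hle := Nat.le_of_dvd hpos hdvd2
    have := Nat.mul_lt_mul'' (Nat.mul_lt_mul'' h1 h2) h3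
    rw [← mul_pow, ← mul_pow] at this
    have h5 := Nat.pow_le_pow_left hle 3
    have : c ^ 3 = c * c * c := by ring
    omega
  have hcard := (Finset.card_le_card hsub).trans ((Finset.card_union_le _ _).trans
    (add_le_add (Finset.card_union_le _ _) Finset.card_image_le))
  simp only [Finset.card_product, Finset.card_univ, ZMod.card] at hcard
  calc (#{p : ZMod c × ZMod c | p.1 * p.2 * (p.1 + p.2 + 2) = 0} : ℝ)
      ≤ (#A * c + c * #A + #A * c : ℕ) := by exact_mod_cast hcard
    _ = 3 * #A * c := by push_cast; ring
    _ ≤ 3 * (#c.divisors * (c : ℝ) ^ (2 / 3 : ℝ)) * c := by gcongr; exact card_large_gcd_le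
    _ = 3 * #c.divisors * (c : ℝ) ^ (5 / 3 : ℝ) := by
      have : (c : ℝ) ^ (5 / 3 : ℝ) = (c : ℝ) ^ (2 / 3 : ℝ) * c := by
        rw [← Real.rpow_add_one hc.ne']; norm_num
      rw [this]; ring

/-- For a solution `(x, y, z, w)`, clearing inverses gives `(z + w)(xy - zw) = 0`. Since `z = x + y
- w`, this reads `(x + y)(x - w)(y - w) = 0`. Divide by `w ^ 3` and put `p = x/w - 1`, `q = y/w -
1`; nothing is lost, because `w`, `p`, `q` recover `x`, `y` and then `z`. -/
lemma card_unit_quadruples_le :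
    #{p : ((ZMod c)ˣ × (ZMod c)ˣ) × ((ZMod c)ˣ × (ZMod c)ˣ) |
      (p.1.1 : ZMod c) + p.1.2 = p.2.1 + p.2.2 ∧
      ((p.1.1⁻¹ : (ZMod c)ˣ) : ZMod c) + (p.1.2⁻¹ : (ZMod c)ˣ) =
        (p.2.1⁻¹ : (ZMod c)ˣ) + (p.2.2⁻¹ : (ZMod c)ˣ)} ≤
    c.totient * #{p : ZMod c × ZMod c | p.1 * p.2 * (p.1 + p.2 + 2) = 0} := by
  rw [← ZMod.card_units_eq_totient, ← Finset.card_univ, ← Finset.card_product]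
  refine Finset.card_le_card_of_injOn
    (fun p => (p.2.2, ((p.1.1 * p.2.2⁻¹ : (ZMod c)ˣ) : ZMod c) - 1,
      ((p.1.2 * p.2.2⁻¹ : (ZMod c)ˣ) : ZMod c) - 1)) ?_ ?_
  · rintro ⟨⟨x, y⟩, z, w⟩ hp
    simp only [Finset.coe_filter, Finset.mem_univ, true_and, Set.mem_ofPred_eq] at hp
    obtain ⟨h1, h2⟩ := hp
    simp only [Finset.coe_product, Set.mem_prod, Finset.coe_univ, Set.mem_univ, true_and,
      Finset.coe_filter, Finset.mem_univ, Set.mem_ofPred_eq, Units.val_mul]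
    have hx := x.mul_inv
    have hy := y.mul_inv
    have hz' := z.mul_inv
    have hw := w.mul_inv
    set x' := ((x⁻¹ : (ZMod c)ˣ) : ZMod c)
    set y' := ((y⁻¹ : (ZMod c)ˣ) : ZMod c)
    set z' := ((z⁻¹ : (ZMod c)ˣ) : ZMod c)
    set w' := ((w⁻¹ : (ZMod c)ˣ) : ZMod c)
    have h3 : ((z : ZMod c) + w) * (x * y - z * w) = 0 := by
      have e1 : (x : ZMod c) * y * (x' + y') = x + y := by linear_combination y * hx + x * hy
      have e2 : (z : ZMod c) * w * (z' + w') = z + w := by linear_combination w * hz' + z * hw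
      rw [h2] at e1
      linear_combination (z * w) * e1 - (x * y) * e2 + z * w * h1
    have hz : (z : ZMod c) = x + y - w := by linear_combination -h1
    rw [hz] at h3
    have hx1 : (x : ZMod c) * w' - 1 = w' * (x - w) := by linear_combination hw
    have hy1 : (y : ZMod c) * w' - 1 = w' * (y - w) := by linear_combination hw
    have hxy : (x : ZMod c) * w' - 1 + (y * w' - 1) + 2 = w' * (x + y) := by ring
    rw [hxy, hx1, hy1]
    linear_combination (w' ^ 3) * h3
  · rintro ⟨⟨x, y⟩, z, w⟩ hp ⟨⟨x₂, y₂⟩, z₂, w₂⟩ hq h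
    simp only [Finset.coe_filter, Finset.mem_univ, true_and, Set.mem_ofPred_eq] at hp hq
    simp only [Prod.mk.injEq, sub_left_inj, Units.val_inj] at h
    obtain ⟨rfl, h1, h2⟩ := h
    have h1 := mul_right_cancel h1
    have h2 := mul_right_cancel h2
    subst h1 h2
    have : z = z₂ := by
      apply Units.ext
      linear_combination hq.1 - hp.1
    rw [this]

lemma sum_kloostermanSum_pow_four_le :
    ∑ m : ZMod c, ∑ n : ZMod c, ‖kloostermanSum c m n‖ ^ 4 ≤
      (c : ℝ) ^ 2 * (c.totient * (3 * #c.divisors * (c : ℝ) ^ (5 / 3 : ℝ))) := by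
  have hsq (m n : ZMod c) : ‖kloostermanSum c m n‖ ^ 4 =
      ‖∑ i : (ZMod c)ˣ × (ZMod c)ˣ, (ZMod.stdAddChar (m * ((i.1 : ZMod c) + (i.2 : ZMod c)) +
        n * (((i.1⁻¹ : (ZMod c)ˣ) : ZMod c) + ((i.2⁻¹ : (ZMod c)ˣ) : ZMod c))) : ℂ)‖ ^ 2 := by
    rw [show (4 : ℕ) = 2 * 2 from rfl, pow_mul, ← norm_pow, sq (kloostermanSum c m n),
      kloostermanSum, Finset.sum_mul_sum, Fintype.sum_prod_type]
    congr 2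
    refine Finset.sum_congr rfl fun i _ => Finset.sum_congr rfl fun j _ => ?_
    rw [← AddChar.map_add_eq_mul]
    congr 1
    ring
  simp_rw [hsq]
  rw [sum_norm_sq_charSum]
  gcongr
  refine le_trans ?_ (mul_le_mul_of_nonneg_left card_prod_eq_zero_le (Nat.cast_nonneg _))
  exact_mod_cast card_unit_quadruples_le

/-- A nonempty fibre is a translate of the kernel of multiplication by `m`, which has at most
`gcd(m, c)` elements. -/
lemma card_mul_eq_le {m : ℤ} (hm : m ≠ 0) (v : ZMod c) :
    #{u : ZMod c | (m : ZMod c) * u = v} ≤ m.natAbs := by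
  have hm' : 0 < m.natAbs := Int.natAbs_pos.2 hm
  rcases Finset.eq_empty_or_nonempty ({u : ZMod c | (m : ZMod c) * u = v} : Finset _) with h | h
  · simp [h]
  obtain ⟨u₀, hu₀⟩ := h
  simp only [Finset.mem_filter, Finset.mem_univ, true_and] at hu₀
  set g := m.natAbs.gcd c with hg
  have hgc : g ∣ c := Nat.gcd_dvd_right _ _
  have hgpos : 0 < g := Nat.gcd_pos_of_pos_left _ hm'
  have hle : #{u : ZMod c | (m : ZMod c) * u = v} ≤ #{p : ZMod c | c / g ∣ p.val} := by
    refine Finset.card_le_card_of_injOn (fun u => u - u₀) (fun u hu => ?_)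
      (sub_left_injective.injOn)
    simp only [Finset.coe_filter, Finset.mem_univ, true_and, Set.mem_ofPred_eq] at hu ⊢
    have h0 : (m : ZMod c) * (u - u₀) = 0 := by rw [mul_sub, hu, hu₀, sub_self]
    have h1 : ((m.natAbs * (u - u₀).val : ℕ) : ZMod c) = 0 := by
      rcases Int.natAbs_eq m with h | h <;> rw [h] at h0 <;> push_cast at h0 ⊢ <;>
        simpa using h0
    rw [ZMod.natCast_eq_zero_iff] at h1
    have hcop : Nat.Coprime (c / g) (m.natAbs / g) := by
      rw [hg, Nat.gcd_comm]; exact Nat.coprime_div_gcd_div_gcd (Nat.gcd_pos_of_pos_right _ hm')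
    refine hcop.dvd_of_dvd_mul_left ?_
    have : g * (c / g) ∣ g * (m.natAbs / g * (u - u₀).val) := by
      rwa [Nat.mul_div_cancel' hgc, ← mul_assoc, Nat.mul_div_cancel' (Nat.gcd_dvd_left _ _)]
    exact Nat.dvd_of_mul_dvd_mul_left hgpos this
  calc _ ≤ _ := hle
    _ ≤ c / (c / g) := card_dvd_val_le (Nat.div_dvd_of_dvd hgc)
    _ = g := Nat.div_div_self hgc (NeZero.ne c)
    _ ≤ m.natAbs := Nat.gcd_le_left _ hm'

/-- The value at `(m, n)` recurs at `(m v, n v⁻¹)` for all `φ(c)` units `v`, and each first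
coordinate occurs at most `|m|` times. So `φ(c)` copies of this fourth power are bounded by `|m|`
times the full fourth moment, whose factor `φ(c)` cancels. -/
lemma norm_kloostermanSum_pow_four_le {m : ℤ} (hm : m ≠ 0) (n : ZMod c) :
    ‖kloostermanSum c m n‖ ^ 4 ≤ 3 * |(m : ℝ)| * #c.divisors * (c : ℝ) ^ (11 / 3 : ℝ) := by
  classical
  have hc : (0 : ℝ) < c := by exact_mod_cast NeZero.pos c
  have hφ : (0 : ℝ) < c.totient := by exact_mod_cast Nat.totient_pos.2 (NeZero.pos c)
  have horbit : c.totient * ‖kloostermanSum c m n‖ ^ 4 ≤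
      |(m : ℝ)| * ∑ k : ZMod c, ∑ l : ZMod c, ‖kloostermanSum c k l‖ ^ 4 := by
    have hfib (k : ZMod c) : #{v : (ZMod c)ˣ | (m : ZMod c) * v = k} ≤ m.natAbs :=
      (Finset.card_le_card_of_injOn (fun v : (ZMod c)ˣ => (v : ZMod c)) (by intro; simp)
        (Units.val_injective.injOn)).trans (card_mul_eq_le hm k)
    calc c.totient * ‖kloostermanSum c m n‖ ^ 4
        = ∑ v : (ZMod c)ˣ, ‖kloostermanSum c (m * v) (n * (v⁻¹ : (ZMod c)ˣ))‖ ^ 4 := by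
          simp [kloostermanSum_mul_unit, ZMod.card_units_eq_totient]
      _ ≤ ∑ v : (ZMod c)ˣ, ∑ l : ZMod c, ‖kloostermanSum c (m * v) l‖ ^ 4 := by
          refine Finset.sum_le_sum fun v _ => ?_
          exact Finset.single_le_sum (f := fun l => ‖kloostermanSum c (m * v) l‖ ^ 4)
            (fun l _ => by positivity) (Finset.mem_univ _)
      _ = ∑ k : ZMod c, #{v : (ZMod c)ˣ | (m : ZMod c) * v = k} *
            ∑ l : ZMod c, ‖kloostermanSum c k l‖ ^ 4 := by
          rw [← Finset.sum_fiberwise' Finset.univ (fun v : (ZMod c)ˣ => (m : ZMod c) * v)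
            (fun k => ∑ l : ZMod c, ‖kloostermanSum c k l‖ ^ 4)]
          simp
      _ ≤ ∑ k : ZMod c, |(m : ℝ)| * ∑ l : ZMod c, ‖kloostermanSum c k l‖ ^ 4 := by
          gcongr with k
          rw [← Int.cast_abs, Int.abs_eq_natAbs]
          exact_mod_cast hfib k
      _ = _ := by rw [Finset.mul_sum]
  have h := horbit.trans (mul_le_mul_of_nonneg_left sum_kloostermanSum_pow_four_le (abs_nonneg _))
  refine le_of_mul_le_mul_left (h.trans_eq ?_) hφ
  have : (c : ℝ) ^ (11 / 3 : ℝ) = (c : ℝ) ^ 2 * (c : ℝ) ^ (5 / 3 : ℝ) := by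
    rw [← Real.rpow_natCast, ← Real.rpow_add hc]; norm_num
  rw [this]; ring

lemma norm_kloostermanSum_le_of_left_ne_zero {m : ℤ} (hm : m ≠ 0) (n : ZMod c) :
    ‖kloostermanSum c m n‖ ≤ 3 * |(m : ℝ)| ^ (1 / 4 : ℝ) *
      (#c.divisors * (c : ℝ) ^ (11 / 12 : ℝ)) := by
  have hc : (0 : ℝ) < c := by exact_mod_cast NeZero.pos c
  have hd : (1 : ℝ) ≤ #c.divisors := by
    exact_mod_cast Finset.card_pos.2 ⟨1, Nat.one_mem_divisors.2 (NeZero.ne c)⟩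
  refine le_of_pow_le_pow_left₀ (n := 4) (by norm_num) (by positivity)
    ((norm_kloostermanSum_pow_four_le hm n).trans ?_)
  have h1 : (|(m : ℝ)| ^ (1 / 4 : ℝ)) ^ 4 = |(m : ℝ)| := by
    rw [← Real.rpow_natCast, ← Real.rpow_mul (abs_nonneg _)]; norm_num
  have h2 : ((c : ℝ) ^ (11 / 12 : ℝ)) ^ 4 = (c : ℝ) ^ (11 / 3 : ℝ) := by
    rw [← Real.rpow_natCast, ← Real.rpow_mul hc.le]; norm_num
  -- Crude, but it avoids fourth roots of the divisor count; likewise `3 ≤ 3 ^ 4` below.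
  have h3 : (#c.divisors : ℝ) ≤ (#c.divisors : ℝ) ^ 4 := le_self_pow₀ hd (by norm_num)
  calc 3 * |(m : ℝ)| * #c.divisors * (c : ℝ) ^ (11 / 3 : ℝ)
      ≤ 3 ^ 4 * |(m : ℝ)| * (#c.divisors : ℝ) ^ 4 * (c : ℝ) ^ (11 / 3 : ℝ) := by
        gcongr; norm_num
    _ = _ := by rw [mul_pow, mul_pow, mul_pow, h1, h2]; ring

/-- A nontrivial bound for Kloosterman sums, by Kloosterman's fourth moment method. -/
lemma norm_kloostermanSum_le {m n : ℤ} (h : m ≠ 0 ∨ n ≠ 0) :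
    ‖kloostermanSum c m n‖ ≤
      3 * ((max 1 |(m : ℝ)|) ^ (1 / 4 : ℝ) * (max 1 |(n : ℝ)|) ^ (1 / 4 : ℝ)) *
      (#c.divisors * (c : ℝ) ^ (11 / 12 : ℝ)) := by
  have key {m n : ℤ} (hm : m ≠ 0) : ‖kloostermanSum c m n‖ ≤
      3 * ((max 1 |(m : ℝ)|) ^ (1 / 4 : ℝ) * (max 1 |(n : ℝ)|) ^ (1 / 4 : ℝ)) *
      (#c.divisors * (c : ℝ) ^ (11 / 12 : ℝ)) := by
    refine (norm_kloostermanSum_le_of_left_ne_zero hm _).trans ?_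
    gcongr
    calc |(m : ℝ)| ^ (1 / 4 : ℝ) ≤ (max 1 |(m : ℝ)|) ^ (1 / 4 : ℝ) * 1 := by
          rw [mul_one]; gcongr; exact le_max_right _ _
      _ ≤ _ := by gcongr; exact Real.one_le_rpow (le_max_left _ _) (by norm_num)
  rcases h with h | h
  · exact key h
  · rw [kloostermanSum_comm, mul_comm ((max 1 |(m : ℝ)|) ^ (1 / 4 : ℝ))]
    exact key h

end Kloosterman

/-! ### Poisson summation and equidistribution of modular inverses. -/

section Decay

open MeasureTheory Filter

/-- The weight `(1 + |x|) ^ (-3/2)`. -/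
noncomputable def decay (x : ℝ) : ℝ := (1 + |x|) ^ (-(3 / 2) : ℝ)

lemma decay_pos (x : ℝ) : 0 < decay x := by unfold decay; positivity

lemma decay_nonneg (x : ℝ) : 0 ≤ decay x := (decay_pos x).le

lemma integrable_decay : Integrable decay := by
  have := integrable_one_add_norm (E := ℝ) (μ := volume) (r := 3 / 2) (by norm_num)
  simpa [decay] using! this

lemma decay_le_rpow {x : ℝ} (hx : x ≠ 0) : decay x ≤ |x| ^ (-(3 / 2) : ℝ) := by
  unfold decay
  exact Real.rpow_le_rpow_of_nonpos (abs_pos.2 hx) (by linarith) (by norm_num)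

lemma summable_decay_int : Summable fun j : ℤ => decay j := by
  have h := Real.summable_abs_int_rpow (b := 3 / 2) (by norm_num)
  refine Summable.of_norm_bounded_eventually (g := fun j : ℤ => |(j : ℝ)| ^ (-(3 / 2) : ℝ)) h ?_
  filter_upwards [(Set.finite_singleton (0 : ℤ)).compl_mem_cofinite] with j hj
  rw [Real.norm_of_nonneg (decay_nonneg _)]
  exact decay_le_rpow (by simpa using hj)

lemma half_rpow_le_decay (x : ℝ) : ((1 + |x|) / 2) ^ (-(3 / 2) : ℝ) ≤ 4 * decay x := by
  unfold decay
  calc ((1 + |x|) / 2) ^ (-(3 / 2) : ℝ)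
      = (1 + |x|) ^ (-(3 / 2) : ℝ) * (2 : ℝ) ^ (3 / 2 : ℝ) := by
        rw [Real.div_rpow (by positivity) (by norm_num), Real.rpow_neg (x := 2) (by norm_num),
          div_inv_eq_mul]
    _ ≤ (1 + |x|) ^ (-(3 / 2) : ℝ) * (2 : ℝ) ^ (2 : ℝ) := by
        gcongr <;> norm_num
    _ = 4 * (1 + |x|) ^ (-(3 / 2) : ℝ) := by norm_num; ring

lemma decay_add_int_le {x : ℝ} (h0 : 0 ≤ x) (h1 : x ≤ 1) (j : ℤ) :
    decay (x + j) ≤ 4 * decay j := by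
  have h : (1 + |(j : ℝ)|) / 2 ≤ 1 + |x + j| := by
    have : |(j : ℝ)| ≤ |x + j| + |x| := by
      calc |(j : ℝ)| = |x + j - x| := by ring_nf
        _ ≤ _ := abs_sub _ _
    rw [abs_of_nonneg h0] at this
    linarith [abs_nonneg (x + j)]
  exact (Real.rpow_le_rpow_of_nonpos (by positivity) h (by norm_num)).trans (half_rpow_le_decay j)

/-- `f` is twice continuously differentiable and `f`, `f'`, `f''` are bounded by `C * decay`. -/
def DecayingC2 (C : ℝ) (f : ℝ → ℂ) : Prop :=
  ∃ f' f'' : ℝ → ℂ, (∀ x, HasDerivAt f (f' x) x) ∧ (∀ x, HasDerivAt f' (f'' x) x) ∧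
    Continuous f'' ∧ ∀ x, ‖f x‖ ≤ C * decay x ∧ ‖f' x‖ ≤ C * decay x ∧ ‖f'' x‖ ≤ C * decay x

lemma integrable_of_norm_le_decay {f : ℝ → ℂ} (hf : Continuous f) {C : ℝ}
    (h : ∀ x, ‖f x‖ ≤ C * decay x) : Integrable f :=
  (integrable_decay.const_mul C).mono' hf.aestronglyMeasurable (Eventually.of_forall h)

lemma DecayingC2.continuous {C : ℝ} {f : ℝ → ℂ} (hf : DecayingC2 C f) : Continuous f := by
  obtain ⟨f', f'', h1, -⟩ := hf
  exact continuous_iff_continuousAt.2 fun x => (h1 x).continuousAt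

lemma DecayingC2.norm_le {C : ℝ} {f : ℝ → ℂ} (hf : DecayingC2 C f) (x : ℝ) :
    ‖f x‖ ≤ C * decay x := by
  obtain ⟨f', f'', -, -, -, h⟩ := hf
  exact (h x).1

lemma DecayingC2.integrable {C : ℝ} {f : ℝ → ℂ} (hf : DecayingC2 C f) : Integrable f :=
  integrable_of_norm_le_decay hf.continuous hf.norm_le

lemma DecayingC2.nonneg {C : ℝ} {f : ℝ → ℂ} (hf : DecayingC2 C f) : 0 ≤ C := by
  have := (norm_nonneg _).trans (hf.norm_le 0)
  exact nonneg_of_mul_nonneg_left this (decay_pos 0)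

lemma norm_fourier_le_of_decay {f : ℝ → ℂ} {C : ℝ} (h : ∀ x, ‖f x‖ ≤ C * decay x) (ξ : ℝ) :
    ‖FourierTransform.fourier f ξ‖ ≤ C * ∫ x, decay x := by
  refine (VectorFourier.norm_fourierIntegral_le_integral_norm _ _ _ _ _).trans ?_
  rw [← integral_const_mul]
  exact integral_mono_of_nonneg (Eventually.of_forall fun x => norm_nonneg _)
    (integrable_decay.const_mul C) (Eventually.of_forall h)

/-- Differentiating twice multiplies the transform by `(2πim) ^ 2`; the `max` absorbs the frequency
`m = 0`. -/
lemma DecayingC2.norm_fourier_le {C : ℝ} {f : ℝ → ℂ} (hf : DecayingC2 C f) (m : ℤ) :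
    ‖FourierTransform.fourier f (m : ℝ)‖ ≤
      C * (∫ x, decay x) * (max 1 |(m : ℝ)|) ^ (-2 : ℝ) := by
  have hC := hf.nonneg
  have hI : 0 ≤ ∫ x, decay x := integral_nonneg decay_nonneg
  rcases eq_or_ne m 0 with rfl | hm
  · simpa using norm_fourier_le_of_decay hf.norm_le 0
  have hint := hf.integrable
  obtain ⟨f', f'', h1, h2, hc, h⟩ := hf
  have hd1 : deriv f = f' := funext fun x => (h1 x).deriv
  have hd2 : deriv f' = f'' := funext fun x => (h2 x).deriv
  have hc' : Continuous f' := continuous_iff_continuousAt.2 fun x => (h2 x).continuousAt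
  have hint' : Integrable f' := integrable_of_norm_le_decay hc' fun x => (h x).2.1
  have hint'' : Integrable f'' := integrable_of_norm_le_decay hc fun x => (h x).2.2
  have e1 := Real.fourier_deriv hint (fun x => (h1 x).differentiableAt) (hd1 ▸ hint')
  have e2 := Real.fourier_deriv hint' (fun x => (h2 x).differentiableAt) (hd2 ▸ hint'')
  rw [hd1] at e1
  rw [hd2] at e2
  have e3 := norm_fourier_le_of_decay (fun x => (h x).2.2) (m : ℝ)
  rw [e2, e1] at e3
  simp only [norm_smul, norm_mul, Complex.norm_ofNat, Complex.norm_real, Complex.norm_I, mul_one,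
    Real.norm_of_nonneg Real.pi_pos.le, Real.norm_eq_abs] at e3
  have hm1 : (1 : ℝ) ≤ |(m : ℝ)| := by exact_mod_cast Int.one_le_abs hm
  rw [max_eq_right hm1, Real.rpow_neg (abs_nonneg _), ← div_eq_mul_inv,
    le_div_iff₀ (by positivity)]
  refine le_trans ?_ e3
  have hpi : (1 : ℝ) ≤ 2 * Real.pi := by linarith [Real.pi_gt_three]
  have : |(m : ℝ)| ^ (2 : ℝ) = |(m : ℝ)| * |(m : ℝ)| := by
    rw [show (2 : ℝ) = ((2 : ℕ) : ℝ) by norm_num, Real.rpow_natCast, sq]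
  rw [this]
  set a := ‖FourierTransform.fourier f (m : ℝ)‖
  calc a * (|(m : ℝ)| * |(m : ℝ)|) = (1 * |(m : ℝ)|) * ((1 * |(m : ℝ)|) * a) := by ring
    _ ≤ _ := by gcongr

lemma summable_max_one_abs_rpow {p : ℝ} (hp : 1 < p) :
    Summable fun m : ℤ => (max 1 |(m : ℝ)|) ^ (-p) := by
  have h := Real.summable_abs_int_rpow hp
  refine Summable.of_norm_bounded_eventually (g := fun j : ℤ => |(j : ℝ)| ^ (-p)) h ?_
  filter_upwards [(Set.finite_singleton (0 : ℤ)).compl_mem_cofinite] with j hj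
  have hj : j ≠ 0 := by simpa using hj
  have hm1 : (1 : ℝ) ≤ |(j : ℝ)| := by exact_mod_cast Int.one_le_abs hj
  rw [max_eq_right hm1, Real.norm_of_nonneg (by positivity)]

lemma DecayingC2.summable_norm_fourier {C : ℝ} {f : ℝ → ℂ} (hf : DecayingC2 C f) :
    Summable fun m : ℤ => ‖FourierTransform.fourier f (m : ℝ)‖ :=
  Summable.of_nonneg_of_le (fun _ => norm_nonneg _) hf.norm_fourier_le
    ((summable_max_one_abs_rpow one_lt_two).mul_left _)

/-- Poisson summation, where the shift by `u / c` becomes an additive character modulo `c`. -/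
lemma DecayingC2.tsum_eq {C : ℝ} {f : ℝ → ℂ} (hf : DecayingC2 C f) {c : ℕ} [NeZero c]
    (u : ZMod c) :
    ∑' j : ℤ, f (u.val / c + j) =
      ∑' m : ℤ, FourierTransform.fourier f (m : ℝ) * ZMod.stdAddChar ((m : ZMod c) * u) := by
  rw [Real.tsum_eq_tsum_fourier_of_rpow_decay_of_summable hf.continuous (b := 3 / 2) (by norm_num)
    ?_ hf.summable_norm_fourier.of_norm]
  · refine tsum_congr fun m => ?_
    congr 1
    have : (m : ZMod c) * u = ((m * u.val : ℤ) : ZMod c) := by push_cast; simp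
    rw [this, ZMod.stdAddChar_coe, fourier_coe_apply]
    congr 1
    push_cast
    ring
  · refine Asymptotics.IsBigO.of_bound C ?_
    filter_upwards [(isCompact_singleton (x := (0 : ℝ))).compl_mem_cocompact] with x hx
    rw [Real.norm_of_nonneg (by positivity)]
    exact (hf.norm_le x).trans (mul_le_mul_of_nonneg_left (decay_le_rpow (by simpa using hx))
      hf.nonneg)

/-- The sum of `f ⊗ g` over the points `(a / c, d / c)` with `a * d ≡ 1` modulo `c`. -/
noncomputable def unitPairSum (c : ℕ) [NeZero c] (f g : ℝ → ℂ) : ℂ :=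
  ∑ u : (ZMod c)ˣ, (∑' j : ℤ, f ((u : ZMod c).val / c + j)) *
    ∑' k : ℤ, g (((u⁻¹ : (ZMod c)ˣ) : ZMod c).val / c + k)

/-- After Poisson in both variables, the sum over `u` of the two phases is a Kloosterman sum. -/
lemma DecayingC2.hasSum_unitPairSum {C D : ℝ} {f g : ℝ → ℂ}
    (hf : DecayingC2 C f) (hg : DecayingC2 D g)
    (c : ℕ) [NeZero c] :
    HasSum (fun p : ℤ × ℤ => FourierTransform.fourier f (p.1 : ℝ) *
        FourierTransform.fourier g (p.2 : ℝ) * kloostermanSum c p.1 p.2)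
      (unitPairSum c f g) := by
  have hsum (u : (ZMod c)ˣ) : HasSum (fun p : ℤ × ℤ => FourierTransform.fourier f (p.1 : ℝ) *
        FourierTransform.fourier g (p.2 : ℝ) * (ZMod.stdAddChar ((p.1 : ZMod c) * (u : ZMod c) +
          (p.2 : ZMod c) * ((u⁻¹ : (ZMod c)ˣ) : ZMod c)) : ℂ))
      ((∑' j : ℤ, f ((u : ZMod c).val / c + j)) *
        ∑' k : ℤ, g (((u⁻¹ : (ZMod c)ˣ) : ZMod c).val / c + k)) := by
    have hsf : Summable fun m : ℤ => ‖FourierTransform.fourier f (m : ℝ) *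
        ZMod.stdAddChar ((m : ZMod c) * (u : ZMod c))‖ := by
      simpa using hf.summable_norm_fourier
    have hsg : Summable fun m : ℤ => ‖FourierTransform.fourier g (m : ℝ) *
        ZMod.stdAddChar ((m : ZMod c) * ((u⁻¹ : (ZMod c)ˣ) : ZMod c))‖ := by
      simpa using hg.summable_norm_fourier
    rw [hf.tsum_eq, hg.tsum_eq, tsum_mul_tsum_of_summable_norm hsf hsg]
    convert! (summable_mul_of_summable_norm hsf hsg).hasSum using 2 with p
    rw [AddChar.map_add_eq_mul]
    ring
  have := hasSum_sum fun u (_ : u ∈ (Finset.univ : Finset (ZMod c)ˣ)) => hsum u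
  simpa only [← Finset.mul_sum, kloostermanSum, unitPairSum] using this

/-- Equidistribution of the points `(u / c, u⁻¹ / c)`, tested against decaying functions. -/
lemma exists_norm_unitPairSum_sub_le : ∃ A : ℝ, 0 ≤ A ∧ ∀ (C D : ℝ) (f g : ℝ → ℂ),
    DecayingC2 C f → DecayingC2 D g → ∀ (c : ℕ) [NeZero c],
      ‖unitPairSum c f g - c.totient * (∫ x, f x) * ∫ x, g x‖ ≤
        A * C * D * (c.divisors.card * (c : ℝ) ^ (11 / 12 : ℝ)) := by
  set I := ∫ x, decay x
  have hI : 0 ≤ I := integral_nonneg decay_nonneg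
  -- `7/4 = 2 - 1/4`: Fourier decay of order 2 less the growth `|m| ^ (1/4)` of the Kloosterman
  -- bound.
  have hb := summable_max_one_abs_rpow (p := 7 / 4) (by norm_num)
  set b : ℤ → ℝ := fun m => (max 1 |(m : ℝ)|) ^ (-(7 / 4) : ℝ)
  have hb0 (m : ℤ) : 0 ≤ b m := by positivity
  refine ⟨3 * I ^ 2 * ((∑' m, b m) * ∑' m, b m), ?_, fun C D f g hf hg c _ => ?_⟩
  · have : 0 ≤ ∑' m, b m := tsum_nonneg hb0
    positivity
  have hC := hf.nonneg
  have hD := hg.nonneg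
  have hsum := (hf.hasSum_unitPairSum hg c)
  have h0 : (c.totient : ℂ) * (∫ x, f x) * (∫ x, g x) =
      FourierTransform.fourier f ((0 : ℤ) : ℝ) * FourierTransform.fourier g ((0 : ℤ) : ℝ) *
        kloostermanSum c ((0 : ℤ) : ZMod c) ((0 : ℤ) : ZMod c) := by
    have hz (f : ℝ → ℂ) : FourierTransform.fourier f ((0 : ℤ) : ℝ) = ∫ x, f x := by
      simp [Real.fourier_eq]
    rw [hz, hz, Int.cast_zero, kloostermanSum_zero_zero]
    ring
  -- Deleting the zero frequency subtracts exactly the main term, as `K(0, 0; c) = φ(c)`.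
  have hsub := hsum.update (0, 0) 0
  simp only [zero_sub, ← h0] at hsub
  rw [show ∀ a b : ℂ, a - b = -b + a from fun a b => by ring, ← hsub.tsum_eq]
  have hbb : HasSum (fun p : ℤ × ℤ => 3 * I ^ 2 * C * D * (c.divisors.card *
      (c : ℝ) ^ (11 / 12 : ℝ)) * (b p.1 * b p.2))
      (3 * I ^ 2 * C * D * (c.divisors.card * (c : ℝ) ^ (11 / 12 : ℝ)) *
        ((∑' m, b m) * ∑' m, b m)) := by
    refine HasSum.mul_left _ ?_
    rw [tsum_mul_tsum_of_summable_norm (by simpa using hb.norm) (by simpa using hb.norm)]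
    exact (hb.mul_of_nonneg hb hb0 hb0).hasSum
  refine (tsum_of_norm_bounded hbb fun p => ?_).trans_eq (by ring)
  obtain ⟨m, n⟩ := p
  by_cases hmn : (m, n) = (0, 0)
  · rw [hmn, Function.update_self, norm_zero]
    have := hb0 0
    positivity
  · rw [Function.update_of_ne hmn, norm_mul, norm_mul]
    have hmn' : m ≠ 0 ∨ n ≠ 0 := by
      by_contra! h
      exact hmn (by rw [h.1, h.2])
    have hpow (m : ℤ) : (max 1 |(m : ℝ)|) ^ (-2 : ℝ) * (max 1 |(m : ℝ)|) ^ (1 / 4 : ℝ) = b m := by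
      rw [← Real.rpow_add (by positivity)]; norm_num [b]
    calc _ ≤ (C * I * (max 1 |(m : ℝ)|) ^ (-2 : ℝ)) * (D * I * (max 1 |(n : ℝ)|) ^ (-2 : ℝ)) *
          (3 * ((max 1 |(m : ℝ)|) ^ (1 / 4 : ℝ) * (max 1 |(n : ℝ)|) ^ (1 / 4 : ℝ)) *
            (c.divisors.card * (c : ℝ) ^ (11 / 12 : ℝ))) := by
          gcongr
          · exact hf.norm_fourier_le m
          · exact hg.norm_fourier_le n
          · exact norm_kloostermanSum_le hmn'
      _ = _ := by rw [← hpow m, ← hpow n]; ring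

end Decay

/-! ### Products of complex powers, and holomorphy of parameter integrals. -/

section CpowPair

open MeasureTheory Filter Topology

/-- The function `(x + z) ^ α * (x + conj z) ^ β` of a real variable `x`. -/
noncomputable def cpowPair (z α β : ℂ) (x : ℝ) : ℂ := (x + z) ^ α * (x + conj z) ^ β

lemma ofReal_add_mem_slitPlane {z : ℂ} (hz : z.im ≠ 0) (x : ℝ) : (x : ℂ) + z ∈ Complex.slitPlane :=
  Or.inr (by simpa using hz)

lemma ofReal_add_conj_mem_slitPlane {z : ℂ} (hz : z.im ≠ 0) (x : ℝ) :
    (x : ℂ) + conj z ∈ Complex.slitPlane :=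
  Or.inr (by simpa using hz)

lemma hasDerivAt_cpowPair {z : ℂ} (hz : z.im ≠ 0) (α β : ℂ) (x : ℝ) :
    HasDerivAt (cpowPair z α β)
      (α * cpowPair z (α - 1) β x + β * cpowPair z α (β - 1) x) x := by
  have h1 (w : ℂ) (γ : ℂ) (hw : (x : ℂ) + w ∈ Complex.slitPlane) :
      HasDerivAt (fun t : ℂ => (t + w) ^ γ) (γ * ((x : ℂ) + w) ^ (γ - 1)) x := by
    simpa using! ((hasDerivAt_id (x : ℂ)).add_const w).cpow_const (c := γ) hw
  have := ((h1 z α (ofReal_add_mem_slitPlane hz x)).mul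
    (h1 (conj z) β (ofReal_add_conj_mem_slitPlane hz x))).comp_ofReal
  convert! this using 1
  simp only [cpowPair]
  ring

lemma continuous_cpowPair {z : ℂ} (hz : z.im ≠ 0) (α β : ℂ) : Continuous (cpowPair z α β) :=
  continuous_iff_continuousAt.2 fun x => (hasDerivAt_cpowPair hz α β x).continuousAt

lemma one_add_abs_le {z : ℂ} (hz : 0 < z.im) (x : ℝ) :
    1 + |x| ≤ (1 + (1 + ‖z‖) / z.im) * ‖(x : ℂ) + z‖ := by
  have h1 : |x| ≤ ‖(x : ℂ) + z‖ + ‖z‖ := by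
    calc |x| = ‖(x : ℂ) + z - z‖ := by simp
      _ ≤ _ := norm_sub_le _ _
  have h2 : z.im ≤ ‖(x : ℂ) + z‖ := by
    simpa [abs_of_pos hz] using Complex.abs_im_le_norm ((x : ℂ) + z)
  have h3 : 1 + ‖z‖ ≤ (1 + ‖z‖) / z.im * ‖(x : ℂ) + z‖ := by
    rw [div_mul_eq_mul_div, le_div_iff₀ hz]; gcongr
  linarith

lemma norm_cpow_le_of_norm_le {B : ℝ} (w : ℂ) {α : ℂ} (hα : ‖α‖ ≤ B) :
    ‖w ^ α‖ ≤ ‖w‖ ^ α.re * Real.exp (Real.pi * B) := by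
  refine (Complex.norm_cpow_le w α).trans ?_
  rw [div_eq_mul_inv, ← Real.exp_neg]
  gcongr
  calc -(w.arg * α.im) ≤ |w.arg * α.im| := neg_le_abs _
    _ = |w.arg| * |α.im| := abs_mul _ _
    _ ≤ Real.pi * B := by
      gcongr
      · exact Complex.abs_arg_le_pi w
      · exact (Complex.abs_im_le_norm α).trans hα

/-- Both bases have the same modulus, at least a constant times `1 + |x|`, and the arguments
contribute at most `exp (π B)` each. The constant depends only on `z` and `B`, as needed for locally
uniform bounds in `s`. -/
lemma exists_norm_cpowPair_le {z : ℂ} (hz : 0 < z.im) (B : ℝ) : ∃ C : ℝ, 0 ≤ C ∧ ∀ α β : ℂ,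
    ‖α‖ ≤ B → ‖β‖ ≤ B → (α + β).re ≤ -(3 / 2) → ∀ x, ‖cpowPair z α β x‖ ≤ C * decay x := by
  set K := 1 + (1 + ‖z‖) / z.im
  have hK1 : 1 ≤ K := le_add_of_nonneg_right (by positivity)
  have hK : 0 < K := by positivity
  refine ⟨Real.exp (Real.pi * B) * Real.exp (Real.pi * B) * K ^ (2 * B), by positivity,
    fun α β hα hβ hr x => ?_⟩
  set t := ‖(x : ℂ) + z‖
  have ht : (1 + |x|) / K ≤ t := by
    rw [div_le_iff₀ hK, mul_comm]; exact one_add_abs_le hz x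
  have ht0 : 0 < t := lt_of_lt_of_le (by positivity) ht
  have hconj : ‖(x : ℂ) + conj z‖ = t := by
    rw [← Complex.norm_conj, map_add, Complex.conj_conj, Complex.conj_ofReal]
  have hB : -(α + β).re ≤ 2 * B := by
    have h1 := (abs_le.1 (Complex.abs_re_le_norm α)).1
    have h2 := (abs_le.1 (Complex.abs_re_le_norm β)).1
    rw [Complex.add_re]; linarith
  have hx1 : 1 ≤ 1 + |x| := le_add_of_nonneg_right (abs_nonneg x)
  calc ‖cpowPair z α β x‖ ≤ (t ^ α.re * Real.exp (Real.pi * B)) *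
        (t ^ β.re * Real.exp (Real.pi * B)) := by
        rw [cpowPair, norm_mul]
        have := norm_cpow_le_of_norm_le ((x : ℂ) + conj z) hβ
        rw [hconj] at this
        gcongr
        exact norm_cpow_le_of_norm_le _ hα
    _ = Real.exp (Real.pi * B) * Real.exp (Real.pi * B) * t ^ (α + β).re := by
        rw [Complex.add_re, Real.rpow_add ht0]; ring
    _ ≤ Real.exp (Real.pi * B) * Real.exp (Real.pi * B) * ((1 + |x|) / K) ^ (α + β).re := by
        exact mul_le_mul_of_nonneg_left
          (Real.rpow_le_rpow_of_nonpos (by positivity) ht (by linarith)) (by positivity)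
    _ = Real.exp (Real.pi * B) * Real.exp (Real.pi * B) *
          (K ^ (-(α + β).re) * (1 + |x|) ^ (α + β).re) := by
        rw [Real.div_rpow (by positivity) hK.le, Real.rpow_neg hK.le, div_eq_inv_mul]
    _ ≤ Real.exp (Real.pi * B) * Real.exp (Real.pi * B) * (K ^ (2 * B) * decay x) := by
        unfold decay
        gcongr
    _ = _ := by ring

/-- The derivatives are combinations of functions of the same kind with an exponent lowered, so the
pointwise bound with `B + 2` covers them; `4 (B + 1) ^ 2` dominates the coefficients. -/
lemma exists_decayingC2_cpowPair {z : ℂ} (hz : 0 < z.im) (B : ℝ) : ∃ C : ℝ, 0 ≤ C ∧ ∀ α β : ℂ,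
    ‖α‖ ≤ B → ‖β‖ ≤ B → (α + β).re ≤ -(3 / 2) → DecayingC2 C (cpowPair z α β) := by
  obtain ⟨C, hC, h⟩ := exists_norm_cpowPair_le hz (B + 2)
  rcases lt_or_ge B 0 with hB | hB
  · exact ⟨0, le_rfl, fun α β hα => absurd (hα.trans_lt hB) (norm_nonneg α).not_gt⟩
  have hsub {α : ℂ} {b : ℝ} (hα : ‖α‖ ≤ b) : ‖α - 1‖ ≤ b + 1 :=
    (norm_sub_le _ _).trans (by rw [norm_one]; linarith)
  refine ⟨4 * (B + 1) ^ 2 * C, by positivity, fun α β hα hβ hr => ?_⟩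
  have hd := hasDerivAt_cpowPair hz.ne'
  refine ⟨_, _, hd α β, fun x => ((hd (α - 1) β x).const_mul α).add ((hd α (β - 1) x).const_mul β),
    ?_, fun x => ?_⟩
  · have := fun α β => continuous_cpowPair hz.ne' α β
    fun_prop
  have hα1 := hsub hα
  have hα2 := hsub hα1
  have hβ1 := hsub hβ
  have hβ2 := hsub hβ1
  simp only [Complex.add_re] at hr
  have e0 := h α β (by linarith) (by linarith) (by simp; linarith) x
  have e1 := h (α - 1) β (by linarith) (by linarith) (by simp; linarith) x
  have e2 := h α (β - 1) (by linarith) (by linarith) (by simp; linarith) x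
  have e3 := h (α - 1 - 1) β (by linarith) (by linarith) (by simp; linarith) x
  have e4 := h (α - 1) (β - 1) (by linarith) (by linarith) (by simp; linarith) x
  have e5 := h α (β - 1 - 1) (by linarith) (by linarith) (by simp; linarith) x
  set M := C * decay x
  have hM : 0 ≤ M := mul_nonneg hC (decay_nonneg x)
  have hrw (k : ℝ) : k * C * decay x = k * M := by ring
  rw [hrw]
  refine ⟨e0.trans (le_mul_of_one_le_left hM (by nlinarith)), ?_, ?_⟩
  · calc _ ≤ B * M + B * M := by
          refine norm_add_le_of_le ?_ ?_ <;> rw [norm_mul] <;> gcongr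
      _ ≤ _ := by
          rw [← add_mul]
          exact mul_le_mul_of_nonneg_right (by nlinarith) hM
  · calc _ ≤ B * ((B + 1) * M + B * M) + B * (B * M + (B + 1) * M) := by
          refine norm_add_le_of_le ?_ ?_ <;> rw [norm_mul] <;> gcongr <;>
          refine norm_add_le_of_le ?_ ?_ <;> rw [norm_mul] <;> gcongr
      _ = (B * (4 * B + 2)) * M := by ring
      _ ≤ _ := mul_le_mul_of_nonneg_right (by nlinarith) hM

/-- Cauchy's estimate on circles of radius `r / 4` turns the bound on `F` into an integrable bound
on its derivative. -/
lemma differentiableOn_integral_of_norm_le {X : Type*} [MeasurableSpace X] {μ : Measure X}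
    {U : Set ℂ} (hU : IsOpen U) {F : ℂ → X → ℂ} (hm : ∀ s, AEStronglyMeasurable (F s) μ)
    (hd : ∀ x, DifferentiableOn ℂ (fun s => F s x) U) {g : X → ℝ} (hg : Integrable g μ)
    (hle : ∀ s ∈ U, ∀ x, ‖F s x‖ ≤ g x) : DifferentiableOn ℂ (fun s => ∫ x, F s x ∂μ) U := by
  intro s₀ hs₀
  obtain ⟨r, hr, hball⟩ := Metric.isOpen_iff.1 hU s₀ hs₀
  have hderiv (x : X) (s : ℂ) (hs : s ∈ U) :
      HasDerivAt (fun s => F s x) (deriv (fun s => F s x) s) s :=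
    ((hd x).differentiableAt (hU.mem_nhds hs)).hasDerivAt
  have hhalf {s : ℂ} (hs : s ∈ Metric.ball s₀ (r / 2)) {t : ℂ}
      (ht : t ∈ Metric.closedBall s (r / 4)) : t ∈ U := by
    apply hball
    rw [Metric.mem_ball] at hs ⊢
    rw [Metric.mem_closedBall] at ht
    linarith [dist_triangle t s s₀]
  refine (hasDerivAt_integral_of_dominated_loc_of_deriv_le (Metric.ball_mem_nhds s₀ (half_pos hr))
    (Eventually.of_forall hm) (hg.mono' (hm s₀) (Eventually.of_forall (hle s₀ hs₀)))
    (F' := fun s x => deriv (fun s => F s x) s) (bound := fun x => g x / (r / 4)) ?_ ?_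
    (hg.div_const _) ?_).2.differentiableAt.differentiableWithinAt
  -- The derivative is measurable in `x` as a limit of difference quotients.
  · refine aestronglyMeasurable_of_tendsto_ae (𝓝[≠] s₀)
      (f := fun s x => slope (fun s => F s x) s₀ s) (fun s => ?_)
      (Eventually.of_forall fun x => (hasDerivAt_iff_tendsto_slope.1 (hderiv x s₀ hs₀)))
    simp only [slope_def_module]
    exact ((hm s).sub (hm s₀)).const_smul (s - s₀)⁻¹
  · refine Eventually.of_forall fun x s hs => ?_
    refine Complex.norm_deriv_le_of_forall_mem_sphere_norm_le (by positivity) ?_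
      fun t ht => hle t (hhalf hs (Metric.sphere_subset_closedBall ht)) x
    exact (hd x).diffContOnCl_ball fun t ht => hhalf hs ht
  · exact Eventually.of_forall fun x s hs =>
      hderiv x s (hhalf hs (Metric.mem_closedBall_self (by positivity)))

end CpowPair

/-! ### The Dirichlet series of Euler's function on multiples of `N`. -/

section DirichletSeries

open Filter Topology

lemma summable_card_divisors_mul_rpow {p : ℝ} (hp : 1 < p) :
    Summable fun n : ℕ => (n.divisors.card : ℝ) * (n : ℝ) ^ (-p) := by
  have h1 : LSeriesSummable 1 (p : ℂ) := LSeriesSummable_one_iff.2 (by simpa using hp)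
  refine (h1.convolution h1).norm.congr fun n => ?_
  rw [LSeries.norm_term_eq]
  rcases eq_or_ne n 0 with rfl | hn
  · simp
  · have hcard : n.divisorsAntidiagonal.card = n.divisors.card := by
      rw [Finset.card_eq_sum_ones, Finset.card_eq_sum_ones]
      exact Nat.sum_divisorsAntidiagonal (fun _ _ => 1)
    rw [if_neg hn, LSeries.convolution_def]
    simp [Real.rpow_neg, div_eq_mul_inv, hcard]

/-- The Dirichlet quotient of `c ↦ φ(c)` on multiples of `N` by the identity. -/
noncomputable def totientCoeff (N n : ℕ) : ℂ :=
  ∑ e ∈ n.divisors with N.lcm e = n, (ArithmeticFunction.moebius e : ℂ) * (n / e : ℕ)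

/-- Since `gcd(N, e) · lcm(N, e) = N e`, an `e` with `lcm(N, e) = n` is determined by the divisor
`gcd(N, e)` of `N`; moreover `n / e ≤ N`. -/
lemma norm_totientCoeff_le {N : ℕ} (hN : N ≠ 0) (n : ℕ) :
    ‖totientCoeff N n‖ ≤ N.divisors.card * N := by
  have hcard : (n.divisors.filter fun e => N.lcm e = n).card ≤ N.divisors.card := by
    refine Finset.card_le_card_of_injOn (fun e => N.gcd e) (fun e he => ?_) fun e he e' he' h => ?_
    · simp [hN, Nat.gcd_dvd_left]
    · simp only [Finset.coe_filter, Set.mem_ofPred_eq] at he he'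
      have h1 := Nat.gcd_mul_lcm N e
      have h2 := Nat.gcd_mul_lcm N e'
      simp only at h
      rw [he.2, h, ← he'.2, h2] at h1
      exact (Nat.eq_of_mul_eq_mul_left (Nat.pos_of_ne_zero hN) h1).symm
  calc ‖totientCoeff N n‖ ≤ ∑ e ∈ n.divisors with N.lcm e = n, (N : ℝ) := by
        refine norm_sum_le_of_le _ fun e he => ?_
        obtain ⟨he1, he2⟩ := Finset.mem_filter.1 he
        have he0 := Nat.pos_of_mem_divisors he1
        have h1 : ‖(ArithmeticFunction.moebius e : ℂ)‖ ≤ 1 := by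
          rw [Complex.norm_intCast]
          exact_mod_cast ArithmeticFunction.abs_moebius_le_one
        have h2 : n / e ≤ N := by
          apply Nat.div_le_of_le_mul
          rw [← he2, mul_comm]
          exact Nat.le_of_dvd (by positivity) (Nat.lcm_dvd_mul N e)
        calc _ ≤ 1 * (N : ℝ) := by
              rw [norm_mul, Complex.norm_natCast]
              gcongr
          _ = N := one_mul _
    _ ≤ _ := by
        rw [Finset.sum_const, nsmul_eq_mul]
        gcongr

/-- Write `φ(c) = ∑ μ(e) c / e` and group the `e ∣ c` by `n = lcm(N, e)`, using `c / e = (n / e)(c /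
n)`. When `N ∤ c`, no such `n` divides `c`. -/
lemma convolution_totientCoeff {N c : ℕ} (hc : c ≠ 0) :
    LSeries.convolution (totientCoeff N) (fun n => (n : ℂ)) c =
      if N ∣ c then (c.totient : ℂ) else 0 := by
  have hφ : (c.totient : ℂ) =
      ∑ e ∈ c.divisors, (ArithmeticFunction.moebius e : ℂ) * (c / e : ℕ) := by
    have h := (ArithmeticFunction.sum_eq_iff_sum_mul_moebius_eq (R := ℂ)
      (f := fun n => (n.totient : ℂ)) (g := fun n => (n : ℂ))).1
      (fun n _ => by exact_mod_cast Nat.sum_totient n) c (Nat.pos_of_ne_zero hc)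
    rw [← h, Nat.sum_divisorsAntidiagonal
      (f := fun a b => (ArithmeticFunction.moebius a : ℂ) * (b : ℂ))]
  simp only [LSeries.convolution_def]
  rw [Nat.sum_divisorsAntidiagonal (f := fun a b => totientCoeff N a * (b : ℂ))]
  simp only [totientCoeff, Finset.sum_mul]
  rw [Finset.sum_sigma', hφ]
  split_ifs with hd
  · symm
    refine Finset.sum_bij (fun e _ => (⟨N.lcm e, e⟩ : (_ : ℕ) × ℕ)) ?_ ?_ ?_ ?_
    · intro e he
      have hec := Nat.dvd_of_mem_divisors he
      have hl : N.lcm e ∣ c := Nat.lcm_dvd hd hec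
      simp [hc, hl, Nat.dvd_lcm_right, ne_zero_of_dvd_ne_zero hc hl]
    · intro e _ e' _ h
      simpa using (Sigma.mk.inj_iff.1 h).2
    · rintro ⟨n, e⟩ h
      simp only [Finset.mem_sigma, Nat.mem_divisors, Finset.mem_filter] at h
      exact ⟨e, by simpa [hc] using h.2.1.1.trans h.1.1, by simp [h.2.2]⟩
    · intro e he
      have hec := Nat.dvd_of_mem_divisors he
      have hl : N.lcm e ∣ c := Nat.lcm_dvd hd hec
      rw [mul_assoc]
      congr 1
      rw [← Nat.cast_mul, mul_comm, Nat.div_mul_div_comm hl (Nat.dvd_lcm_right _ _), mul_comm,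
        Nat.mul_div_mul_left _ _ (Nat.pos_of_ne_zero (ne_zero_of_dvd_ne_zero hc hl))]
  · refine Finset.sum_eq_zero ?_
    rintro ⟨n, e⟩ h
    simp only [Finset.mem_sigma, Nat.mem_divisors, Finset.mem_filter] at h
    exact absurd ((h.2.2 ▸ Nat.dvd_lcm_left N e).trans h.1.1) hd

lemma lseriesSummable_totientCoeff {N : ℕ} (hN : N ≠ 0) {t : ℂ} (ht : 1 < t.re) :
    LSeriesSummable (totientCoeff N) t :=
  LSeriesSummable_of_bounded_of_one_lt_re (fun n _ => norm_totientCoeff_le hN n) ht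

lemma differentiableOn_lseries_totientCoeff {N : ℕ} (hN : N ≠ 0) :
    DifferentiableOn ℂ (LSeries (totientCoeff N)) {t | 1 < t.re} := by
  refine (LSeries_differentiableOn _).mono fun t ht => ?_
  refine lt_of_le_of_lt (LSeries.abscissaOfAbsConv_le_of_le_const
    ⟨N.divisors.card * N, fun n _ => norm_totientCoeff_le hN n⟩) ?_
  exact_mod_cast ht

/-- With `t = 4s - 2`, the point `s = 1` is `t = 2`: only the zeta factor is singular there, the
other being holomorphic for `re t > 1`. -/
lemma hasSum_totient_multiples {N : ℕ} (hN : N ≠ 0) {t : ℂ} (ht : 2 < t.re) :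
    HasSum (fun c : {c : ℕ // N ∣ c ∧ c ≠ 0} => ((c : ℕ).totient : ℂ) * ((c : ℕ) : ℂ) ^ (-t))
      (riemannZeta (t - 1) * LSeries (totientCoeff N) t) := by
  have h1 := lseriesSummable_totientCoeff hN (t := t) (by linarith)
  have hid (n : ℕ) : LSeries.term (fun n => (n : ℂ)) t n = LSeries.term 1 (t - 1) n := by
    rcases eq_or_ne n 0 with rfl | hn
    · simp
    · have hn' : (n : ℂ) ≠ 0 := by exact_mod_cast hn
      rw [LSeries.term_of_ne_zero hn, LSeries.term_of_ne_zero hn, Complex.cpow_sub _ _ hn',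
        Complex.cpow_one, Pi.one_apply, one_div_div]
  have h2 : LSeriesSummable (fun n => (n : ℂ)) t := by
    rw [LSeriesSummable, funext hid]
    exact LSeriesSummable_one_iff.2 (by simp; linarith)
  have h2' : LSeries (fun n => (n : ℂ)) t = riemannZeta (t - 1) := by
    rw [← LSeries_one_eq_riemannZeta (by simp; linarith), LSeries, LSeries]
    exact tsum_congr hid
  have h3 := (h1.convolution h2).hasSum
  rw [show ∑' n, LSeries.term (LSeries.convolution (totientCoeff N) fun n => (n : ℂ)) t n =
    riemannZeta (t - 1) * LSeries (totientCoeff N) t from by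
      rw [← h2', mul_comm, ← LSeries_convolution' h1 h2, LSeries]] at h3
  have hind : Set.indicator {c : ℕ | N ∣ c ∧ c ≠ 0}
      (fun c => ((c : ℕ).totient : ℂ) * (c : ℂ) ^ (-t))
      = LSeries.term (LSeries.convolution (totientCoeff N) fun n => (n : ℂ)) t := by
    ext c
    by_cases hc : c = 0
    · subst hc; simp
    · rw [LSeries.term_of_ne_zero hc, convolution_totientCoeff hc]
      by_cases hd : N ∣ c
      · rw [Set.indicator_of_mem (show c ∈ {c : ℕ | N ∣ c ∧ c ≠ 0} from ⟨hd, hc⟩), if_pos hd,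
          Complex.cpow_neg, div_eq_mul_inv]
      · rw [Set.indicator_of_notMem fun h => hd h.1, if_neg hd, zero_div]
  rw [← hind] at h3
  exact (hasSum_subtype_iff_indicator (s := {c : ℕ | N ∣ c ∧ c ≠ 0})).2 h3

/-- `(s - 1) * ζ(s)`, extended continuously to `s = 1`. -/
noncomputable def zetaRegularized : ℂ → ℂ := Function.update (fun s => (s - 1) * riemannZeta s) 1 1

lemma zetaRegularized_of_ne {s : ℂ} (hs : s ≠ 1) : zetaRegularized s = (s - 1) * riemannZeta s :=
  Function.update_of_ne hs _ _

lemma differentiable_zetaRegularized : Differentiable ℂ zetaRegularized := by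
  intro s
  have hd {s : ℂ} (hs : s ≠ 1) : DifferentiableAt ℂ zetaRegularized s := by
    refine DifferentiableAt.congr_of_eventuallyEq (f := fun s => (s - 1) * riemannZeta s)
      ((differentiableAt_id.sub_const 1).mul (differentiableAt_riemannZeta hs)) ?_
    filter_upwards [isOpen_ne.mem_nhds hs] with t ht using zetaRegularized_of_ne ht
  rcases eq_or_ne s 1 with rfl | hs
  · refine (Complex.analyticAt_of_differentiable_on_punctured_nhds_of_continuousAt
      ?_ ?_).differentiableAt
    · filter_upwards [self_mem_nhdsWithin] with t ht using hd ht
    · exact continuousAt_update_same.2 riemannZeta_residue_one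
  · exact hd hs

end DirichletSeries

/-! ### Continuation of the leading part. -/

section MainTerm

open MeasureTheory Filter Topology

instance {N : ℕ} (c : {c : ℕ // N ∣ c ∧ c ≠ 0}) : NeZero (c : ℕ) := ⟨c.2.2⟩

lemma differentiableOn_unitPairSum {U : Set ℂ} (hU : IsOpen U) {f g : ℂ → ℝ → ℂ} {C D : ℝ}
    (hf : ∀ s ∈ U, DecayingC2 C (f s)) (hg : ∀ s ∈ U, DecayingC2 D (g s))
    (hfd : ∀ x, DifferentiableOn ℂ (fun s => f s x) U)
    (hgd : ∀ x, DifferentiableOn ℂ (fun s => g s x) U) (c : ℕ) [NeZero c] :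
    DifferentiableOn ℂ (fun s => unitPairSum c (f s) (g s)) U := by
  have key {f : ℂ → ℝ → ℂ} {C : ℝ} (hf : ∀ s ∈ U, DecayingC2 C (f s))
      (hfd : ∀ x, DifferentiableOn ℂ (fun s => f s x) U) (u : ZMod c) :
      DifferentiableOn ℂ (fun s => ∑' j : ℤ, f s (u.val / c + j)) U := by
    have hx0 : (0 : ℝ) ≤ u.val / c := by positivity
    have hx1 : (u.val : ℝ) / c ≤ 1 :=
      div_le_one_of_le₀ (by exact_mod_cast (ZMod.val_lt u).le) (Nat.cast_nonneg c)
    refine Complex.differentiableOn_tsum_of_summable_norm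
      (summable_decay_int.mul_left (C * 4)) (fun j => hfd _) hU fun j s hs => ?_
    refine ((hf s hs).norm_le _).trans ?_
    rw [mul_assoc]
    exact mul_le_mul_of_nonneg_left (decay_add_int_le hx0 hx1 j) (hf s hs).nonneg
  unfold unitPairSum
  exact DifferentiableOn.fun_sum fun u _ => (key hf hfd _).mul (key hg hgd _)

lemma differentiableOn_natCast_cpow {c : ℕ} (hc : c ≠ 0) (U : Set ℂ) :
    DifferentiableOn ℂ (fun s : ℂ => (c : ℂ) ^ (2 - 4 * s)) U := by
  refine DifferentiableOn.const_cpow (by fun_prop) (Or.inl ?_)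
  exact_mod_cast hc

lemma differentiableOn_and_summable_equidistribution_error {N : ℕ} {U : Set ℂ} (hU : IsOpen U)
    (hre : ∀ s ∈ U, 95 / 96 < s.re) {f g : ℂ → ℝ → ℂ} {C D : ℝ}
    (hf : ∀ s ∈ U, DecayingC2 C (f s)) (hg : ∀ s ∈ U, DecayingC2 D (g s))
    (hfd : ∀ x, DifferentiableOn ℂ (fun s => f s x) U)
    (hgd : ∀ x, DifferentiableOn ℂ (fun s => g s x) U)
    (hfi : DifferentiableOn ℂ (fun s => ∫ x, f s x) U)
    (hgi : DifferentiableOn ℂ (fun s => ∫ x, g s x) U) :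
    DifferentiableOn ℂ (fun s => ∑' c : {c : ℕ // N ∣ c ∧ c ≠ 0}, ((c : ℕ) : ℂ) ^ (2 - 4 * s) *
      (unitPairSum c (f s) (g s) - (c : ℕ).totient * (∫ x, f s x) * ∫ x, g s x)) U ∧
    ∀ s ∈ U, Summable fun c : {c : ℕ // N ∣ c ∧ c ≠ 0} => ((c : ℕ) : ℂ) ^ (2 - 4 * s) *
      (unitPairSum c (f s) (g s) - (c : ℕ).totient * (∫ x, f s x) * ∫ x, g s x) := by
  obtain ⟨A, hA, h⟩ := exists_norm_unitPairSum_sub_le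
  have hu : Summable fun c : {c : ℕ // N ∣ c ∧ c ≠ 0} =>
      A * C * D * (((c : ℕ).divisors.card : ℝ) * ((c : ℕ) : ℝ) ^ (-(25 / 24) : ℝ)) :=
    ((summable_card_divisors_mul_rpow (by norm_num)).subtype _).mul_left _
  have hle (c : {c : ℕ // N ∣ c ∧ c ≠ 0}) (s : ℂ) (hs : s ∈ U) : ‖((c : ℕ) : ℂ) ^ (2 - 4 * s) *
      (unitPairSum c (f s) (g s) - (c : ℕ).totient * (∫ x, f s x) * ∫ x, g s x)‖ ≤
      A * C * D * (((c : ℕ).divisors.card : ℝ) * ((c : ℕ) : ℝ) ^ (-(25 / 24) : ℝ)) := by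
    have hc0 : 0 < (c : ℕ) := Nat.pos_of_ne_zero c.2.2
    have hc1 : (1 : ℝ) ≤ (c : ℕ) := by exact_mod_cast hc0
    have hCD : 0 ≤ A * C * D := mul_nonneg (mul_nonneg hA (hf s hs).nonneg) (hg s hs).nonneg
    rw [norm_mul, Complex.norm_natCast_cpow_of_pos hc0]
    -- Origin of `95/96`: `2 - 4 · 95/96 = -47/24`, and adding `11/12` leaves `-25/24 < -1`.
    have hexp : (2 - 4 * s).re ≤ -(47 / 24) := by
      have := hre s hs
      simp
      linarith
    calc _ ≤ ((c : ℕ) : ℝ) ^ (-(47 / 24) : ℝ) *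
          (A * C * D * ((c : ℕ).divisors.card * ((c : ℕ) : ℝ) ^ (11 / 12 : ℝ))) := by
          gcongr
          exact h C D _ _ (hf s hs) (hg s hs) c
      _ = A * C * D * ((c : ℕ).divisors.card *
            (((c : ℕ) : ℝ) ^ (-(47 / 24) : ℝ) * ((c : ℕ) : ℝ) ^ (11 / 12 : ℝ))) := by ring
      _ = _ := by
          rw [← Real.rpow_add (by positivity)]
          norm_num
  refine ⟨Complex.differentiableOn_tsum_of_summable_norm hu (fun c => ?_) hU hle,
    fun s hs => Summable.of_norm_bounded hu fun c => hle c s hs⟩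
  exact (differentiableOn_natCast_cpow c.2.2 U).mul
    ((differentiableOn_unitPairSum hU hf hg hfd hgd c).sub ((hfi.const_mul _).mul hgi))

/-- The factor depending on `a / c` of the leading term of the summand. -/
noncomputable def leadX (w s : ℂ) : ℝ → ℂ := cpowPair (-conj w) (1 - 2 * s) (1 - 2 * s)

/-- The factor depending on `d / c` of the leading term of the summand. -/
noncomputable def leadY (z s : ℂ) : ℝ → ℂ := cpowPair z (-(2 * s)) (2 - 2 * s)

/-- For both functions the exponents add up to `2 - 4s`, with real part at most `-3/2` exactly when
`re s ≥ 7/8`. -/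
lemma exists_decayingC2_lead {z w : ℂ} (hz : 0 < z.im) (hw : 0 < w.im) (R : ℝ) :
    ∃ C : ℝ, 0 ≤ C ∧ ∀ s : ℂ, 7 / 8 ≤ s.re → ‖s‖ ≤ R →
      DecayingC2 C (leadX w s) ∧ DecayingC2 C (leadY z s) := by
  obtain ⟨C, hC, hX⟩ := exists_decayingC2_cpowPair (z := -conj w) (by simpa using hw) (2 + 2 * R)
  obtain ⟨D, hD, hY⟩ := exists_decayingC2_cpowPair hz (2 + 2 * R)
  have hmono {A B : ℝ} {f : ℝ → ℂ} (hAB : A ≤ B) (hf : DecayingC2 A f) : DecayingC2 B f := by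
    obtain ⟨f', f'', h1, h2, h3, h⟩ := hf
    have hle (x : ℝ) := mul_le_mul_of_nonneg_right hAB (decay_nonneg x)
    exact ⟨f', f'', h1, h2, h3, fun x => ⟨(h x).1.trans (hle x), (h x).2.1.trans (hle x),
      (h x).2.2.trans (hle x)⟩⟩
  refine ⟨max C D, le_max_of_le_left hC, fun s hs hR => ?_⟩
  have h2s : ‖2 * s‖ ≤ 2 * R := by rw [norm_mul, Complex.norm_ofNat]; gcongr
  have hsub (a : ℂ) (ha : ‖a‖ ≤ 2) : ‖a - 2 * s‖ ≤ 2 + 2 * R :=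
    (norm_sub_le _ _).trans (add_le_add ha h2s)
  have h0 := hsub 0 (by simp)
  rw [zero_sub] at h0
  exact ⟨hmono (le_max_left _ _) (hX _ _ (hsub 1 (by simp)) (hsub 1 (by simp))
      (by simp; linarith)), hmono (le_max_right _ _) (hY _ _ h0 (hsub 2 (by simp))
      (by simp; linarith))⟩

lemma differentiable_cpowPair_param {z : ℂ} (hz : z.im ≠ 0) {α β : ℂ → ℂ} (hα : Differentiable ℂ α)
    (hβ : Differentiable ℂ β) (x : ℝ) : Differentiable ℂ fun s => cpowPair z (α s) (β s) x := by
  unfold cpowPair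
  exact (hα.const_cpow (Or.inl (Complex.slitPlane_ne_zero (ofReal_add_mem_slitPlane hz x)))).mul
    (hβ.const_cpow (Or.inl (Complex.slitPlane_ne_zero (ofReal_add_conj_mem_slitPlane hz x))))

lemma differentiable_leadX {w : ℂ} (hw : 0 < w.im) (x : ℝ) :
    Differentiable ℂ fun s => leadX w s x :=
  differentiable_cpowPair_param (by simpa using hw.ne') (by fun_prop) (by fun_prop) x

lemma differentiable_leadY {z : ℂ} (hz : 0 < z.im) (x : ℝ) :
    Differentiable ℂ fun s => leadY z s x :=
  differentiable_cpowPair_param hz.ne' (by fun_prop) (by fun_prop) x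

/-- The integrand is `(x + z) ^ (-2)`, with primitive `-(x + z)⁻¹` vanishing at both ends. This zero
cancels the pole of zeta. -/
lemma integral_leadY_one {z : ℂ} (hz : 0 < z.im) : ∫ x, leadY z 1 x = 0 := by
  obtain ⟨C, -, hC⟩ := exists_decayingC2_lead hz hz 1
  have hint := (hC 1 (by norm_num) (by simp)).2.integrable
  have hne (x : ℝ) : (x : ℂ) + z ≠ 0 :=
    Complex.slitPlane_ne_zero (ofReal_add_mem_slitPlane hz.ne' x)
  have hder (x : ℝ) : HasDerivAt (fun x : ℝ => -((x : ℂ) + z)⁻¹) (leadY z 1 x) x := by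
    have := (((hasDerivAt_id (x : ℂ)).add_const z).inv (hne x)).neg.comp_ofReal
    convert! this using 1
    simp [leadY, cpowPair, Complex.cpow_neg, div_eq_mul_inv]
  have hlim (l : Filter ℝ) (hl : Tendsto (fun x : ℝ => |x|) l atTop) :
      Tendsto (fun x : ℝ => -((x : ℂ) + z)⁻¹) l (𝓝 0) := by
    rw [← neg_zero]
    refine (tendsto_inv₀_cobounded.comp (tendsto_norm_atTop_iff_cobounded.1 ?_)).neg
    refine tendsto_atTop_mono (fun x => ?_) (tendsto_atTop_add_const_right l (-‖z‖) hl)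
    have := norm_sub_le ((x : ℂ) + z) z
    rw [add_sub_cancel_right, Complex.norm_real, Real.norm_eq_abs] at this
    linarith
  rw [integral_of_hasDerivAt_of_tendsto hder hint (hlim _ tendsto_abs_atBot_atTop)
    (hlim _ tendsto_abs_atTop_atTop), sub_zero]

/-- Continuation of the leading part of the series past `re s = 1`. -/
lemma exists_continuation_unitPairSum {N : ℕ} (hN : N ≠ 0) {z w : ℂ} (hz : 0 < z.im)
    (hw : 0 < w.im) : ∃ M : ℂ → ℂ, DifferentiableOn ℂ M {s | 95 / 96 < s.re} ∧
      ∀ s : ℂ, 1 < s.re → HasSum (fun c : {c : ℕ // N ∣ c ∧ c ≠ 0} =>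
        ((c : ℕ) : ℂ) ^ (2 - 4 * s) * unitPairSum c (leadX w s) (leadY z s)) (M s) := by
  set U : Set ℂ := {s | 95 / 96 < s.re} with hUdef
  have hU : IsOpen U := isOpen_lt continuous_const Complex.continuous_re
  have hUR (R : ℝ) : IsOpen (U ∩ Metric.ball 0 R) := hU.inter Metric.isOpen_ball
  -- The decay constants depend on a bound for `‖s‖`, so holomorphy is proved on bounded pieces.
  have hlocal {F : ℂ → ℂ} (h : ∀ R, DifferentiableOn ℂ F (U ∩ Metric.ball 0 R)) :
      DifferentiableOn ℂ F U := fun s hs =>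
    ((h (‖s‖ + 1)).differentiableAt ((hUR _).mem_nhds ⟨hs, by simp⟩)).differentiableWithinAt
  have hdec (R : ℝ) : ∃ C : ℝ, ∀ s ∈ U ∩ Metric.ball 0 R,
      DecayingC2 C (leadX w s) ∧ DecayingC2 C (leadY z s) := by
    obtain ⟨C, -, h⟩ := exists_decayingC2_lead hz hw R
    refine ⟨C, fun s hs => h s ?_ (mem_ball_zero_iff.1 hs.2).le⟩
    have : 95 / 96 < s.re := hs.1
    linarith
  have hIX : DifferentiableOn ℂ (fun s => ∫ x, leadX w s x) U := hlocal fun R => by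
    obtain ⟨C, h⟩ := hdec R
    exact differentiableOn_integral_of_norm_le (hUR R)
      (fun s => (continuous_cpowPair (by simpa using hw.ne') _ _).aestronglyMeasurable)
      (fun x => (differentiable_leadX hw x).differentiableOn) (integrable_decay.const_mul C)
      fun s hs x => (h s hs).1.norm_le x
  have hIY : DifferentiableOn ℂ (fun s => ∫ x, leadY z s x) U := hlocal fun R => by
    obtain ⟨C, h⟩ := hdec R
    exact differentiableOn_integral_of_norm_le (hUR R)
      (fun s => (continuous_cpowPair hz.ne' _ _).aestronglyMeasurable)
      (fun x => (differentiable_leadY hz x).differentiableOn) (integrable_decay.const_mul C)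
      fun s hs x => (h s hs).2.norm_le x
  choose C hC using hdec
  have herr (R : ℝ) := differentiableOn_and_summable_equidistribution_error (N := N) (hUR R)
      (fun s hs => hs.1) (fun s hs => (hC R s hs).1) (fun s hs => (hC R s hs).2)
      (fun x => (differentiable_leadX hw x).differentiableOn)
      (fun x => (differentiable_leadY hz x).differentiableOn)
      (hIX.mono Set.inter_subset_left) (hIY.mono Set.inter_subset_left)
  set E : ℂ → ℂ := fun s => ∑' c : {c : ℕ // N ∣ c ∧ c ≠ 0}, ((c : ℕ) : ℂ) ^ (2 - 4 * s) *
      (unitPairSum c (leadX w s) (leadY z s) -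
        (c : ℕ).totient * (∫ x, leadX w s x) * ∫ x, leadY z s x)
  have h1U : (1 : ℂ) ∈ U := by norm_num [hUdef]
  -- Away from `1`, `∫ leadY` is `(s - 1)` times the slope and `ζ(4s - 3)` is `zetaRegularized (4s -
  -- 3) / (4 (s - 1))`; the factors `s - 1` cancel.
  refine ⟨fun s => E s + (∫ x, leadX w s x) * (dslope (fun s => ∫ x, leadY z s x) 1 s *
    (zetaRegularized (4 * s - 3) / 4) * LSeries (totientCoeff N) (4 * s - 2)), ?_, fun s hs => ?_⟩
  · refine (hlocal fun R => (herr R).1).add (hIX.mul ((DifferentiableOn.mul ?_ ?_).mul ?_))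
    · exact (Complex.differentiableOn_dslope (hU.mem_nhds h1U)).2 hIY
    · exact ((differentiable_zetaRegularized.comp (by fun_prop)).div_const 4).differentiableOn
    · refine (differentiableOn_lseries_totientCoeff hN).comp (by fun_prop) fun s hs => ?_
      have : 95 / 96 < s.re := hs
      simp
      linarith
  · have hsU : s ∈ U := by rw [hUdef, Set.mem_ofPred_eq]; linarith
    have hs1 : s ≠ 1 := by rintro rfl; simp at hs
    have h1 : HasSum _ (E s) := ((herr (‖s‖ + 1)).2 s ⟨hsU, by simp⟩).hasSum
    have h2 := ((hasSum_totient_multiples hN (t := 4 * s - 2) (by simp; linarith)).mul_left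
      ((∫ x, leadX w s x) * ∫ x, leadY z s x))
    have hJ := sub_smul_dslope (fun s => ∫ x, leadY z s x) 1 s
    simp only [integral_leadY_one hz, sub_zero, smul_eq_mul] at hJ
    convert! h1.add h2 using 1
    · ext c
      rw [show -(4 * s - 2) = 2 - 4 * s by ring]
      ring
    · have hs3 : 4 * s - 3 ≠ 1 := fun h => hs1 (by linear_combination h / 4)
      beta_reduce
      generalize E s = e
      rw [zetaRegularized_of_ne hs3, ← hJ, show 4 * s - 2 - 1 = 4 * s - 3 by ring]
      ring

end MainTerm

/-! ### The multiplicative factor of the summand and its leading term. -/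

section HeckeFactor

/-- The function `conj ζ / |ζ| ^ (2 s)`. -/
noncomputable def heckeFactor (s ζ : ℂ) : ℂ := conj ζ / (‖ζ‖ : ℂ) ^ (2 * s)

lemma heckeFactor_mul (s ζ ξ : ℂ) : heckeFactor s (ζ * ξ) = heckeFactor s ζ * heckeFactor s ξ := by
  unfold heckeFactor
  rw [map_mul, norm_mul, Complex.ofReal_mul,
    Complex.mul_cpow_ofReal_nonneg (norm_nonneg _) (norm_nonneg _), mul_div_mul_comm]

lemma cauchyTerm_eq (γ : SL(2, ℤ)) (z w s : ℂ) :
    cauchyTerm γ z w s = heckeFactor s (mu γ z (-w)) * heckeFactor s (mu γ z (-conj w)) := by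
  unfold cauchyTerm heckeFactor
  rw [mul_div_mul_comm]

lemma differentiable_heckeFactor {ζ : ℂ} (hζ : ζ ≠ 0) :
    Differentiable ℂ fun s => heckeFactor s ζ := by
  have hζ' : (‖ζ‖ : ℂ) ≠ 0 := by simpa using hζ
  unfold heckeFactor
  refine Differentiable.fun_div (by fun_prop) (Differentiable.const_cpow (by fun_prop) (Or.inl hζ'))
    fun s => ?_
  simp [Complex.cpow_eq_zero_iff, hζ]

lemma norm_heckeFactor {s ζ : ℂ} (hζ : ζ ≠ 0) : ‖heckeFactor s ζ‖ = ‖ζ‖ ^ (1 - 2 * s.re) := by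
  have h : 0 < ‖ζ‖ := norm_pos_iff.2 hζ
  rw [heckeFactor, norm_div, Complex.norm_conj, Complex.norm_cpow_eq_rpow_re_of_pos h,
    Real.rpow_sub h, Real.rpow_one]
  simp

lemma heckeFactor_eq_exp {s ζ : ℂ} (hζ : ζ ≠ 0) :
    heckeFactor s ζ = conj ζ * Complex.exp (-(2 * s) * (Real.log ‖ζ‖ : ℝ)) := by
  have h : 0 < ‖ζ‖ := norm_pos_iff.2 hζ
  rw [heckeFactor, Complex.cpow_def_of_ne_zero (by exact_mod_cast h.ne'),
    ← Complex.ofReal_log h.le, div_eq_mul_inv, ← Complex.exp_neg]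
  congr 2
  ring

/-- Off the cut the principal logarithms of `ζ` and `conj ζ` add up to `2 log |ζ|`. -/
lemma heckeFactor_of_mem_slitPlane {ζ : ℂ} (hζ : ζ ∈ Complex.slitPlane) (s : ℂ) :
    heckeFactor s ζ = ζ ^ (-s) * conj ζ ^ (1 - s) := by
  have h0 : ζ ≠ 0 := Complex.slitPlane_ne_zero hζ
  have h0' : conj ζ ≠ 0 := by simpa using h0
  have hlog : Complex.log ζ + Complex.log (conj ζ) = 2 * (Real.log ‖ζ‖ : ℝ) := by
    rw [Complex.log_conj _ (Complex.slitPlane_arg_ne_pi hζ), Complex.add_conj, Complex.log_re]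
    push_cast
    ring
  rw [heckeFactor_eq_exp h0, Complex.cpow_sub _ _ h0', Complex.cpow_one,
    Complex.cpow_def_of_ne_zero h0, Complex.cpow_def_of_ne_zero h0', mul_div_assoc',
    mul_comm (Complex.exp _), mul_div_assoc, ← Complex.exp_sub]
  congr 2
  linear_combination s * hlog

lemma heckeFactor_intCast_sq (s : ℂ) {c : ℤ} (hc : c ≠ 0) :
    heckeFactor s c * heckeFactor s c = ((c.natAbs : ℕ) : ℂ) ^ (2 - 4 * s) := by
  have hc' : ((c.natAbs : ℕ) : ℂ) ≠ 0 := by exact_mod_cast Int.natAbs_ne_zero.2 hc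
  have hn : ‖(c : ℂ)‖ = ((c.natAbs : ℕ) : ℝ) := by
    rw [Complex.norm_intCast, Nat.cast_natAbs, Int.cast_abs]
  have hsq : (c : ℂ) * c = ((c.natAbs : ℕ) : ℂ) ^ (2 : ℂ) := by
    have : (c : ℂ) * c = ((c.natAbs : ℕ) : ℂ) * ((c.natAbs : ℕ) : ℂ) := by
      rw [← Nat.cast_mul, ← Int.cast_mul, ← Int.natAbs_mul_self, Int.cast_natCast]
    rw [this, show (2 : ℂ) = ((2 : ℕ) : ℂ) by norm_num, Complex.cpow_natCast, sq]
  rw [heckeFactor, hn, map_intCast, div_mul_div_comm, hsq, Complex.ofReal_natCast,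
    ← Complex.cpow_add _ _ hc', ← Complex.cpow_sub _ _ hc']
  congr 1
  ring

/-- For `|ε| ≤ 1/2` one has `|log |1 - ε|| ≤ (3/2) |ε|`, and `exp` is Lipschitz on the bounded set
of exponents that arises. -/
lemma exists_norm_heckeFactor_sub_one_le {R : ℝ} (hR : 0 ≤ R) : ∃ C : ℝ, 0 ≤ C ∧
    ∀ s ε : ℂ, ‖s‖ ≤ R → ‖ε‖ ≤ 1 / 2 →
      ‖heckeFactor s (1 - ε) - 1‖ ≤ C * ‖ε‖ ∧ ‖heckeFactor s (1 - ε)‖ ≤ 1 + C := by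
  refine ⟨1 + 2 * (3 * R * Real.exp (3 * R)), by positivity, fun s ε hs hε => ?_⟩
  have hne : 1 - ε ≠ 0 := by
    intro h
    have : ε = 1 := (sub_eq_zero.1 h).symm
    rw [this, norm_one] at hε
    norm_num at hε
  have hlog : ‖((Real.log ‖1 - ε‖ : ℝ) : ℂ)‖ ≤ 3 / 2 * ‖ε‖ := by
    have h1 := Complex.norm_log_one_add_half_le_self (z := -ε) (by simpa using hε)
    rw [← sub_eq_add_neg, norm_neg] at h1
    rw [Complex.norm_real, ← Complex.log_re]
    exact (Complex.abs_re_le_norm _).trans h1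
  set v := -(2 * s) * ((Real.log ‖1 - ε‖ : ℝ) : ℂ)
  have hv : ‖v‖ ≤ 3 * R * ‖ε‖ := by
    rw [norm_mul, norm_neg, norm_mul, Complex.norm_ofNat]
    calc 2 * ‖s‖ * ‖((Real.log ‖1 - ε‖ : ℝ) : ℂ)‖ ≤ 2 * R * (3 / 2 * ‖ε‖) := by gcongr
      _ = _ := by ring
  have hv1 : ‖v‖ ≤ 3 * R := hv.trans (mul_le_of_le_one_right (by positivity) (by linarith))
  have hexp : ‖Complex.exp v - 1‖ ≤ 3 * R * ‖ε‖ * Real.exp (3 * R) := by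
    calc ‖Complex.exp v - 1‖ ≤ ‖v‖ * Real.exp ‖v‖ := by
          have := Complex.norm_exp_sub_sum_le_norm_mul_exp v 1
          simpa using this
      _ ≤ _ := by gcongr
  have h1ε : ‖1 - ε‖ ≤ 2 := (norm_sub_le _ _).trans (by rw [norm_one]; linarith)
  have hmain : ‖heckeFactor s (1 - ε) - 1‖ ≤ (1 + 2 * (3 * R * Real.exp (3 * R))) * ‖ε‖ := by
    rw [heckeFactor_eq_exp hne]
    calc ‖conj (1 - ε) * Complex.exp v - 1‖ =
          ‖conj (1 - ε) * (Complex.exp v - 1) + -conj ε‖ := by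
            rw [map_sub, map_one]; ring_nf
      _ ≤ 2 * (3 * R * ‖ε‖ * Real.exp (3 * R)) + ‖ε‖ := by
          refine norm_add_le_of_le ?_ (by rw [norm_neg, Complex.norm_conj])
          rw [norm_mul, Complex.norm_conj]
          gcongr
      _ = _ := by ring
  refine ⟨hmain, ?_⟩
  calc ‖heckeFactor s (1 - ε)‖ = ‖1 + (heckeFactor s (1 - ε) - 1)‖ := by ring_nf
    _ ≤ 1 + (1 + 2 * (3 * R * Real.exp (3 * R))) * ‖ε‖ :=
        norm_add_le_of_le norm_one.le hmain
    _ ≤ _ := by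
        gcongr
        exact mul_le_of_le_one_right (by positivity) (by linarith)

/-- The leading term of `cauchyTerm` for matrices with large lower left entry. -/
noncomputable def leadTerm (γ : SL(2, ℤ)) (z w s : ℂ) : ℂ :=
  (((γ 1 0).natAbs : ℕ) : ℂ) ^ (2 - 4 * s) *
    (leadX w s ((γ 0 0 : ℝ) / (γ 1 0 : ℝ)) * leadY z s ((γ 1 1 : ℝ) / (γ 1 0 : ℝ)))

lemma leadX_eq {w : ℂ} (hw : 0 < w.im) (s : ℂ) (x : ℝ) :
    leadX w s x = heckeFactor s (x - w) * heckeFactor s (x - conj w) := by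
  have h1 := ofReal_add_mem_slitPlane (z := -w) (by simpa using hw.ne') x
  have h2 := ofReal_add_conj_mem_slitPlane (z := -w) (by simpa using hw.ne') x
  have e1 : (x : ℂ) - w ≠ 0 := by simpa [sub_eq_add_neg] using Complex.slitPlane_ne_zero h1
  have e2 : (x : ℂ) - conj w ≠ 0 := by simpa [sub_eq_add_neg] using Complex.slitPlane_ne_zero h2
  rw [map_neg] at h2
  rw [sub_eq_add_neg, sub_eq_add_neg, heckeFactor_of_mem_slitPlane h1,
    heckeFactor_of_mem_slitPlane h2, leadX, cpowPair]
  simp only [map_neg, map_sub, Complex.conj_conj, Complex.conj_ofReal, ← sub_eq_add_neg]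
  rw [show 1 - 2 * s = -s + (1 - s) by ring, Complex.cpow_add _ _ e1, Complex.cpow_add _ _ e2]
  ring

lemma leadY_eq {z : ℂ} (hz : 0 < z.im) (s : ℂ) (x : ℝ) :
    leadY z s x = heckeFactor s (x + z) * heckeFactor s (x + z) := by
  have h1 := ofReal_add_mem_slitPlane hz.ne' x
  have e1 := Complex.slitPlane_ne_zero h1
  have e2 := Complex.slitPlane_ne_zero (ofReal_add_conj_mem_slitPlane hz.ne' x)
  rw [heckeFactor_of_mem_slitPlane h1, leadY, cpowPair, map_add, Complex.conj_ofReal,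
    show -(2 * s) = -s + -s by ring, show 2 - 2 * s = (1 - s) + (1 - s) by ring,
    Complex.cpow_add _ _ e1, Complex.cpow_add _ _ e2]
  ring

/-- Multiplicativity applied to `(a - c v)(c z + d) / c = c (a/c - v)(d/c + z)` for `v = w` and `v =
conj w`. -/
lemma leadTerm_eq {z w : ℂ} (hz : 0 < z.im) (hw : 0 < w.im) (s : ℂ) {γ : SL(2, ℤ)}
    (hc : γ 1 0 ≠ 0) : leadTerm γ z w s =
      heckeFactor s (((γ 0 0 : ℂ) - γ 1 0 * w) * (γ 1 0 * z + γ 1 1) / γ 1 0) *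
      heckeFactor s (((γ 0 0 : ℂ) - γ 1 0 * conj w) * (γ 1 0 * z + γ 1 1) / γ 1 0) := by
  have hc' : (γ 1 0 : ℂ) ≠ 0 := by exact_mod_cast hc
  have e (v : ℂ) : ((γ 0 0 : ℂ) - γ 1 0 * v) * (γ 1 0 * z + γ 1 1) / γ 1 0 =
      (γ 1 0 : ℂ) * ((((γ 0 0 : ℝ) / (γ 1 0 : ℝ) : ℝ) : ℂ) - v) *
        ((((γ 1 1 : ℝ) / (γ 1 0 : ℝ) : ℝ) : ℂ) + z) := by
    push_cast
    field_simp
    ring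
  rw [e, e, leadTerm, ← heckeFactor_intCast_sq s hc, leadX_eq hw, leadY_eq hz]
  simp only [heckeFactor_mul]
  ring

end HeckeFactor

/-! ### Parametrization of the matrices with nonzero lower left entry. -/

section Parametrization

/-- Parameters for the elements of `Γ₀(N)` with nonzero lower left entry: a sign, the absolute
value `c` of the lower left entry, a unit modulo `c` and two integers. -/
abbrev Gamma0Param (N : ℕ) : Type :=
  ℤˣ × Σ c : {c : ℕ // N ∣ c ∧ c ≠ 0}, (ZMod c)ˣ × ℤ × ℤ

namespace Gamma0Param

variable {N : ℕ}

/-- The upper left entry, up to sign. -/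
def a (p : Gamma0Param N) : ℤ := (p.2.2.1 : ZMod p.2.1).val + (p.2.1 : ℕ) * p.2.2.2.1

/-- The lower right entry, up to sign. -/
def d (p : Gamma0Param N) : ℤ :=
  ((p.2.2.1⁻¹ : (ZMod p.2.1)ˣ) : ZMod p.2.1).val + (p.2.1 : ℕ) * p.2.2.2.2

lemma dvd (p : Gamma0Param N) : ((p.2.1 : ℕ) : ℤ) ∣ p.a * p.d - 1 := by
  have : ((p.2.1 : ℕ) : ZMod p.2.1) = 0 := ZMod.natCast_self _
  rw [← ZMod.intCast_zmod_eq_zero_iff_dvd]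
  simp [a, d]

/-- The matrix with the given parameters. -/
def toSL (p : Gamma0Param N) : SL(2, ℤ) :=
  ⟨!![p.1 * p.a, p.1 * ((p.a * p.d - 1) / ((p.2.1 : ℕ) : ℤ));
    p.1 * ((p.2.1 : ℕ) : ℤ), p.1 * p.d], by
    have h := Int.ediv_mul_cancel p.dvd
    have h1 : (p.1 : ℤ) * p.1 = 1 := Int.units_coe_mul_self p.1
    rw [Matrix.det_fin_two_of]
    linear_combination h1 - (p.1 : ℤ) * p.1 * h⟩

lemma toSL_apply_one_zero (p : Gamma0Param N) : p.toSL 1 0 = p.1 * ((p.2.1 : ℕ) : ℤ) := rfl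
lemma toSL_apply_zero_zero (p : Gamma0Param N) : p.toSL 0 0 = p.1 * p.a := rfl
lemma toSL_apply_one_one (p : Gamma0Param N) : p.toSL 1 1 = p.1 * p.d := rfl

lemma natAbs_toSL (p : Gamma0Param N) : (p.toSL 1 0).natAbs = p.2.1 := by
  rw [toSL_apply_one_zero, Int.natAbs_mul, Int.units_natAbs, one_mul, Int.natAbs_natCast]

lemma toSL_mem (p : Gamma0Param N) : p.toSL ∈ CongruenceSubgroup.Gamma0 N := by
  rw [CongruenceSubgroup.Gamma0_mem, toSL_apply_one_zero, ZMod.intCast_zmod_eq_zero_iff_dvd]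
  exact Dvd.dvd.mul_left (Int.natCast_dvd_natCast.2 p.2.1.2.1) _

lemma toSL_ne_zero (p : Gamma0Param N) : p.toSL 1 0 ≠ 0 := by
  rw [← Int.natAbs_ne_zero, natAbs_toSL]
  exact p.2.1.2.2

end Gamma0Param

lemma SL2_ext_of_ne_zero {γ δ : SL(2, ℤ)} (hc : γ 1 0 ≠ 0) (h10 : γ 1 0 = δ 1 0)
    (h00 : γ 0 0 = δ 0 0) (h11 : γ 1 1 = δ 1 1) : γ = δ := by
  have h1 := Matrix.det_fin_two γ.1
  have h2 := Matrix.det_fin_two δ.1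
  rw [γ.2] at h1
  rw [δ.2] at h2
  have h01 : γ 0 1 = δ 0 1 := by
    apply mul_right_cancel₀ hc
    change 1 = γ 0 0 * γ 1 1 - γ 0 1 * γ 1 0 at h1
    change 1 = δ 0 0 * δ 1 1 - δ 0 1 * δ 1 0 at h2
    rw [h00, h11] at h1
    rw [← h10] at h2
    linarith
  ext i j
  fin_cases i <;> fin_cases j <;> assumption

/-- The subset of `Γ₀(N)` of matrices with nonzero lower left entry. -/
def bigCell (N : ℕ) : Set (CongruenceSubgroup.Gamma0 N) := {γ | (γ : SL(2, ℤ)) 1 0 ≠ 0}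

/-- With `ε` the sign of the lower left entry, the determinant makes `εa` and `εd` inverse modulo
`c`; their residues give the unit and their quotients the two integers. The upper right entry is
then forced because `c ≠ 0`. -/
lemma bijective_toSL (N : ℕ) : Function.Bijective
    (fun p : Gamma0Param N => (⟨⟨p.toSL, p.toSL_mem⟩, p.toSL_ne_zero⟩ : bigCell N)) := by
  constructor
  · intro p q h
    have h : p.toSL = q.toSL :=
      congrArg (fun γ : bigCell N => ((γ : CongruenceSubgroup.Gamma0 N) : SL(2, ℤ))) h
    have hc : (p.2.1 : ℕ) = q.2.1 := by rw [← p.natAbs_toSL, ← q.natAbs_toSL, h]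
    have h10 : p.toSL 1 0 = q.toSL 1 0 := by rw [h]
    have h00 : p.toSL 0 0 = q.toSL 0 0 := by rw [h]
    have h11 : p.toSL 1 1 = q.toSL 1 1 := by rw [h]
    obtain ⟨ε, c, u, j, k⟩ := p
    obtain ⟨ε', c', u', j', k'⟩ := q
    obtain rfl : c = c' := Subtype.ext hc
    have hc0 : ((c : ℕ) : ℤ) ≠ 0 := by exact_mod_cast c.2.2
    simp only [Gamma0Param.toSL_apply_one_zero] at h10
    obtain rfl : ε = ε' := Units.ext (mul_right_cancel₀ hc0 h10)
    rw [Gamma0Param.toSL_apply_zero_zero, Gamma0Param.toSL_apply_zero_zero] at h00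
    rw [Gamma0Param.toSL_apply_one_one, Gamma0Param.toSL_apply_one_one] at h11
    have ha := mul_left_cancel₀ ε.ne_zero h00
    have hd := mul_left_cancel₀ ε.ne_zero h11
    simp only [Gamma0Param.a] at ha
    simp only [Gamma0Param.d] at hd
    have hu : (u : ZMod c) = u' := by
      have := congrArg (fun t : ℤ => (t : ZMod c)) ha
      simpa using this
    obtain rfl : u = u' := Units.ext hu
    obtain rfl : j = j' := mul_left_cancel₀ hc0 (add_left_cancel ha)
    obtain rfl : k = k' := mul_left_cancel₀ hc0 (add_left_cancel hd)
    rfl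
  · rintro ⟨⟨γ, hγ⟩, hc⟩
    change γ 1 0 ≠ 0 at hc
    rw [CongruenceSubgroup.Gamma0_mem, ZMod.intCast_zmod_eq_zero_iff_dvd] at hγ
    have hNc : N ∣ (γ 1 0).natAbs := Int.natCast_dvd.1 hγ
    set c : {c : ℕ // N ∣ c ∧ c ≠ 0} := ⟨(γ 1 0).natAbs, hNc, Int.natAbs_ne_zero.2 hc⟩ with hcdef
    have : NeZero (c : ℕ) := ⟨c.2.2⟩
    obtain ⟨ε, hε⟩ : ∃ ε : ℤˣ, γ 1 0 = ε * ((c : ℕ) : ℤ) := by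
      rcases Int.natAbs_eq (γ 1 0) with h | h
      · exact ⟨1, by simpa [hcdef] using h⟩
      · exact ⟨-1, by simpa [hcdef] using h⟩
    have hεε : (ε : ℤ) * ε = 1 := Int.units_coe_mul_self ε
    have hdet : γ 0 0 * γ 1 1 - γ 0 1 * γ 1 0 = 1 := by
      have h1 := Matrix.det_fin_two γ.1
      rw [γ.2] at h1
      exact h1.symm
    have hmod : ((ε * γ 0 0 : ℤ) : ZMod c) * ((ε * γ 1 1 : ℤ) : ZMod c) = 1 := by
      have : (ε * γ 0 0 : ℤ) * (ε * γ 1 1) = 1 + ε * γ 0 1 * ((c : ℕ) : ℤ) := by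
        rw [hε] at hdet
        linear_combination (γ 0 0 * γ 1 1) * hεε + hdet
      rw [← Int.cast_mul, this]
      simp
    set u : (ZMod c)ˣ := ⟨_, _, hmod, by rw [mul_comm]; exact hmod⟩
    have hrep (t : ℤ) : ((t : ZMod c).val : ℤ) + ((c : ℕ) : ℤ) * (t / ((c : ℕ) : ℤ)) = t := by
      rw [ZMod.val_intCast, Int.emod_add_mul_ediv]
    refine ⟨⟨ε, c, u, ε * γ 0 0 / ((c : ℕ) : ℤ), ε * γ 1 1 / ((c : ℕ) : ℤ)⟩, ?_⟩
    refine Subtype.ext (Subtype.ext (SL2_ext_of_ne_zero (Gamma0Param.toSL_ne_zero _) ?_ ?_ ?_))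
    · exact hε.symm
    · refine (congrArg (fun t : ℤ => (ε : ℤ) * t) (hrep (ε * γ 0 0))).trans ?_
      rw [← mul_assoc, hεε, one_mul]
    · refine (congrArg (fun t : ℤ => (ε : ℤ) * t) (hrep (ε * γ 1 1))).trans ?_
      rw [← mul_assoc, hεε, one_mul]

/-- The parametrization of the matrices in `Γ₀(N)` with nonzero lower left entry. -/
noncomputable def bigCellEquiv (N : ℕ) : Gamma0Param N ≃ bigCell N :=
  Equiv.ofBijective _ (bijective_toSL N)

end Parametrization

/-! ### Summing the leading terms over the group. -/

section LeadingSum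

namespace Gamma0Param

variable {N : ℕ}

lemma toSL_div_a (p : Gamma0Param N) : (p.toSL 0 0 : ℝ) / (p.toSL 1 0 : ℝ) =
    ((p.2.2.1 : ZMod p.2.1).val : ℝ) / (p.2.1 : ℕ) + p.2.2.2.1 := by
  have hc : ((p.2.1 : ℕ) : ℝ) ≠ 0 := by exact_mod_cast p.2.1.2.2
  have hε : ((p.1 : ℤ) : ℝ) ≠ 0 := by exact_mod_cast p.1.ne_zero
  rw [toSL_apply_zero_zero, toSL_apply_one_zero, a]
  push_cast
  rw [mul_div_mul_left _ _ hε, add_div, mul_div_cancel_left₀ _ hc]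

lemma toSL_div_d (p : Gamma0Param N) : (p.toSL 1 1 : ℝ) / (p.toSL 1 0 : ℝ) =
    (((p.2.2.1⁻¹ : (ZMod p.2.1)ˣ) : ZMod p.2.1).val : ℝ) / (p.2.1 : ℕ) + p.2.2.2.2 := by
  have hc : ((p.2.1 : ℕ) : ℝ) ≠ 0 := by exact_mod_cast p.2.1.2.2
  have hε : ((p.1 : ℤ) : ℝ) ≠ 0 := by exact_mod_cast p.1.ne_zero
  rw [toSL_apply_one_one, toSL_apply_one_zero, d]
  push_cast
  rw [mul_div_mul_left _ _ hε, add_div, mul_div_cancel_left₀ _ hc]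

end Gamma0Param

lemma val_div_mem_unit {c : ℕ} [NeZero c] (u : ZMod c) :
    0 ≤ (u.val : ℝ) / c ∧ (u.val : ℝ) / c ≤ 1 :=
  ⟨by positivity, div_le_one_of_le₀ (by exact_mod_cast (ZMod.val_lt u).le) (Nat.cast_nonneg c)⟩

lemma DecayingC2.summable_norm_shift {C : ℝ} {f : ℝ → ℂ} (hf : DecayingC2 C f) {x : ℝ}
    (h0 : 0 ≤ x) (h1 : x ≤ 1) : Summable fun j : ℤ => ‖f (x + j)‖ := by
  refine Summable.of_nonneg_of_le (fun _ => norm_nonneg _) (fun j => ?_)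
    (summable_decay_int.mul_left (C * 4))
  rw [mul_assoc]
  exact (hf.norm_le _).trans (mul_le_mul_of_nonneg_left (decay_add_int_le h0 h1 j) hf.nonneg)

/-- The weight dominating the summands with nonzero lower left entry. -/
noncomputable def cellWeight (ρ : ℝ) (γ : SL(2, ℤ)) : ℝ :=
  ((γ 1 0).natAbs : ℝ) ^ (-ρ) *
    (decay ((γ 0 0 : ℝ) / (γ 1 0 : ℝ)) * decay ((γ 1 1 : ℝ) / (γ 1 0 : ℝ)))

lemma cellWeight_nonneg (ρ : ℝ) (γ : SL(2, ℤ)) : 0 ≤ cellWeight ρ γ :=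
  mul_nonneg (by positivity) (mul_nonneg (decay_nonneg _) (decay_nonneg _))

/-- Each `c` carries `φ(c) ≤ c` units, so the comparison series is that of `c ^ (1 - ρ)`. -/
lemma summable_Gamma0Param_weight {N : ℕ} {ρ : ℝ} (hρ : 2 < ρ) {v : ℤ × ℤ → ℝ}
    (hv : Summable v) (hv0 : ∀ x, 0 ≤ v x) :
    Summable fun p : Gamma0Param N => ((p.2.1 : ℕ) : ℝ) ^ (-ρ) * v p.2.2.2 := by
  have hfib (c : {c : ℕ // N ∣ c ∧ c ≠ 0}) :
      HasSum (fun y : (ZMod c)ˣ × ℤ × ℤ => v y.2) ((c : ℕ).totient * ∑' x, v x) := by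
    have h1 : HasSum (fun _ : (ZMod c)ˣ => (1 : ℝ)) (c : ℕ).totient := by
      simpa [ZMod.card_units_eq_totient] using hasSum_fintype fun _ : (ZMod c)ˣ => (1 : ℝ)
    simpa using h1.mul hv.hasSum
      (h1.summable.mul_of_nonneg hv (fun _ => zero_le_one) hv0)
  have hsig : Summable fun x : Σ c : {c : ℕ // N ∣ c ∧ c ≠ 0}, (ZMod c)ˣ × ℤ × ℤ =>
      ((x.1 : ℕ) : ℝ) ^ (-ρ) * v x.2.2 := by
    have hfib' (c : {c : ℕ // N ∣ c ∧ c ≠ 0}) :=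
      (hfib c).mul_left (((c : ℕ) : ℝ) ^ (-ρ))
    refine (summable_sigma_of_nonneg fun x => mul_nonneg (Real.rpow_nonneg (Nat.cast_nonneg _) _)
      (hv0 _)).2 ⟨fun c => (hfib' c).summable, ?_⟩
    refine (summable_congr fun c => (hfib' c).tsum_eq).2 ?_
    have hnat : Summable fun n : ℕ => (n : ℝ) ^ (-(ρ - 1)) * ∑' x, v x :=
      (Real.summable_nat_rpow.2 (by linarith)).mul_right _
    have hS : 0 ≤ ∑' x, v x := tsum_nonneg hv0
    refine Summable.of_nonneg_of_le (fun c => by positivity) (fun c => ?_)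
      (hnat.subtype {c : ℕ | N ∣ c ∧ c ≠ 0})
    have hc : (0 : ℝ) < (c : ℕ) := by exact_mod_cast Nat.pos_of_ne_zero c.2.2
    calc ((c : ℕ) : ℝ) ^ (-ρ) * ((c : ℕ).totient * ∑' x, v x)
        ≤ ((c : ℕ) : ℝ) ^ (-ρ) * ((c : ℕ) * ∑' x, v x) := by
          gcongr
          exact Nat.totient_le _
      _ = (((c : ℕ) : ℝ) ^ (-ρ) * (c : ℕ)) * ∑' x, v x := by ring
      _ = _ := by
          rw [← Real.rpow_add_one hc.ne', show -ρ + 1 = -(ρ - 1) by ring]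
          rfl
  have h1 : Summable fun _ : ℤˣ => (1 : ℝ) := Summable.of_finite
  simpa using h1.mul_of_nonneg hsig (fun _ => zero_le_one)
    fun x => mul_nonneg (by positivity) (hv0 _)

lemma summable_cellWeight_toSL {N : ℕ} {ρ : ℝ} (hρ : 2 < ρ) :
    Summable fun p : Gamma0Param N => cellWeight ρ p.toSL := by
  have hv : Summable fun x : ℤ × ℤ => (4 * decay x.1) * (4 * decay x.2) :=
    (summable_decay_int.mul_left 4).mul_of_nonneg (summable_decay_int.mul_left 4)
      (fun _ => mul_nonneg (by norm_num) (decay_nonneg _))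
      fun _ => mul_nonneg (by norm_num) (decay_nonneg _)
  have hprod := summable_Gamma0Param_weight (N := N) hρ hv fun x =>
    mul_nonneg (mul_nonneg (by norm_num) (decay_nonneg _))
      (mul_nonneg (by norm_num) (decay_nonneg _))
  refine Summable.of_nonneg_of_le (fun p => cellWeight_nonneg _ _) (fun p => ?_) hprod
  have hx := val_div_mem_unit (p.2.2.1 : ZMod p.2.1)
  have hy := val_div_mem_unit ((p.2.2.1⁻¹ : (ZMod p.2.1)ˣ) : ZMod p.2.1)
  have h1 := decay_add_int_le hx.1 hx.2 p.2.2.2.1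
  have h2 := decay_add_int_le hy.1 hy.2 p.2.2.2.2
  rw [cellWeight, p.natAbs_toSL, p.toSL_div_a, p.toSL_div_d]
  exact mul_le_mul_of_nonneg_left (mul_le_mul h1 h2 (decay_nonneg _)
    (mul_nonneg (by norm_num) (decay_nonneg _))) (by positivity)

lemma summable_cellWeight {N : ℕ} {ρ : ℝ} (hρ : 2 < ρ) :
    Summable fun γ : bigCell N => cellWeight ρ (γ : CongruenceSubgroup.Gamma0 N) :=
  (bigCellEquiv N).summable_iff.1 (summable_cellWeight_toSL hρ)

lemma norm_leadTerm_le {z w s : ℂ} {C ρ : ℝ} (hX : DecayingC2 C (leadX w s))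
    (hY : DecayingC2 C (leadY z s)) (hρ : ρ ≤ 4 * s.re - 2) {γ : SL(2, ℤ)} (hc : γ 1 0 ≠ 0) :
    ‖leadTerm γ z w s‖ ≤ C ^ 2 * cellWeight ρ γ := by
  have hc0 : 0 < (γ 1 0).natAbs := Int.natAbs_pos.2 hc
  have hc1 : (1 : ℝ) ≤ (γ 1 0).natAbs := by exact_mod_cast hc0
  have hC := hX.nonneg
  rw [leadTerm, norm_mul, norm_mul, Complex.norm_natCast_cpow_of_pos hc0, cellWeight]
  calc _ ≤ ((γ 1 0).natAbs : ℝ) ^ (-ρ) * ((C * decay ((γ 0 0 : ℝ) / (γ 1 0 : ℝ))) *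
        (C * decay ((γ 1 1 : ℝ) / (γ 1 0 : ℝ)))) := by
        have := mul_nonneg hC (decay_nonneg ((γ 0 0 : ℝ) / (γ 1 0 : ℝ)))
        gcongr
        · simp; linarith
        · exact hX.norm_le _
        · exact hY.norm_le _
    _ = _ := by ring

/-- For `re s > 1` the weight exponent `4 re s - 2` exceeds 2, so absolute convergence permits
regrouping by `c`. The factor 2 counts the two signs. -/
lemma hasSum_leadTerm {N : ℕ} {z w s M : ℂ} (hz : 0 < z.im) (hw : 0 < w.im) (hs : 1 < s.re)
    (hM : HasSum (fun c : {c : ℕ // N ∣ c ∧ c ≠ 0} =>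
      ((c : ℕ) : ℂ) ^ (2 - 4 * s) * unitPairSum c (leadX w s) (leadY z s)) M) :
    HasSum (fun γ : bigCell N => leadTerm (γ : CongruenceSubgroup.Gamma0 N) z w s) (2 * M) := by
  obtain ⟨C, -, hC⟩ := exists_decayingC2_lead hz hw ‖s‖
  obtain ⟨hX, hY⟩ := hC s (by linarith) le_rfl
  have hsum : Summable fun γ : bigCell N =>
      leadTerm (γ : CongruenceSubgroup.Gamma0 N) z w s :=
    Summable.of_norm_bounded ((summable_cellWeight (ρ := 4 * s.re - 2) (by linarith)).mul_left
      (C ^ 2)) fun γ => norm_leadTerm_le hX hY le_rfl γ.2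
  set G : (Σ c : {c : ℕ // N ∣ c ∧ c ≠ 0}, (ZMod c)ˣ × ℤ × ℤ) → ℂ := fun x =>
    ((x.1 : ℕ) : ℂ) ^ (2 - 4 * s) *
      (leadX w s (((x.2.1 : ZMod x.1).val : ℝ) / (x.1 : ℕ) + x.2.2.1) *
        leadY z s ((((x.2.1⁻¹ : (ZMod x.1)ˣ) : ZMod x.1).val : ℝ) / (x.1 : ℕ) + x.2.2.2)) with hG
  have hlead (p : Gamma0Param N) : leadTerm p.toSL z w s = G p.2 := by
    rw [leadTerm, p.natAbs_toSL, p.toSL_div_a, p.toSL_div_d]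
  have hsumP : Summable fun p : Gamma0Param N => G p.2 :=
    ((bigCellEquiv N).summable_iff.2 hsum).congr hlead
  have hsumG : Summable G := hsumP.comp_injective (i := fun x => ((1 : ℤˣ), x))
    (Prod.mk_right_injective _)
  have hfib (c : {c : ℕ // N ∣ c ∧ c ≠ 0}) : HasSum (fun y => G ⟨c, y⟩)
      (((c : ℕ) : ℂ) ^ (2 - 4 * s) * unitPairSum c (leadX w s) (leadY z s)) := by
    have hc := hsumG.sigma_factor c
    convert! hc.hasSum using 1
    rw [hc.tsum_prod, tsum_fintype, unitPairSum, Finset.mul_sum]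
    refine Finset.sum_congr rfl fun u _ => ?_
    have hx := val_div_mem_unit (u : ZMod c)
    have hy := val_div_mem_unit ((u⁻¹ : (ZMod c)ˣ) : ZMod c)
    rw [tsum_mul_tsum_of_summable_norm (hX.summable_norm_shift hx.1 hx.2)
      (hY.summable_norm_shift hy.1 hy.2), ← tsum_mul_left]
  have hGM : HasSum G M := by
    have h1 := hsumG.hasSum.sigma hfib
    rw [← h1.unique hM]
    exact hsumG.hasSum
  have htwo : HasSum (fun _ : ℤˣ => (1 : ℂ)) 2 := by
    simpa using hasSum_fintype fun _ : ℤˣ => (1 : ℂ)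
  have hP : HasSum (fun p : Gamma0Param N => G p.2) (2 * M) := by
    have := htwo.mul hGM (by simpa using hsumP)
    simpa using this
  refine (bigCellEquiv N).hasSum_iff.1 ?_
  exact hP.congr_fun hlead

end LeadingSum

/-! ### Comparison of the summand with its leading term. -/

section Assembly

/-- A series of entire functions dominated, off finite sets, by summable sequences on bounded parts
of an open set `U` converges to a differentiable function on `U`. -/
lemma exists_differentiableOn_hasSum_of_bounded_off_finite {ι : Type*} {U : Set ℂ} (hU : IsOpen U)
    {F : ι → ℂ → ℂ} (hF : ∀ i, Differentiable ℂ (F i))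
    (h : ∀ R : ℝ, 0 ≤ R → ∃ (u : ι → ℝ) (S : Set ι), Summable u ∧ S.Finite ∧
      ∀ i ∉ S, ∀ s ∈ U, ‖s‖ ≤ R → ‖F i s‖ ≤ u i) :
    ∃ A : ℂ → ℂ, DifferentiableOn ℂ A U ∧ ∀ s ∈ U, HasSum (fun i => F i s) (A s) := by
  classical
  have hbound (R : ℝ) (hR : 0 ≤ R) : ∃ u : ι → ℝ, Summable u ∧
      ∀ i, ∀ s ∈ U ∩ Metric.ball 0 R, ‖F i s‖ ≤ u i := by
    obtain ⟨u, S, hu, hS, hle⟩ := h R hR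
    have hcomp (i : ι) : ∃ B, ∀ s ∈ Metric.closedBall (0 : ℂ) R, ‖F i s‖ ≤ B :=
      (isCompact_closedBall (0 : ℂ) R).exists_bound_of_continuousOn (hF i).continuous.continuousOn
    choose B hB using hcomp
    -- The finitely many exceptional terms need only their maximum on a compact ball.
    refine ⟨fun i => if i ∈ S then B i else u i, ?_, fun i s hs => ?_⟩
    · refine hu.congr_cofinite ?_
      filter_upwards [hS.compl_mem_cofinite] with i hi
      rw [if_neg hi]
    · have hsR : ‖s‖ ≤ R := (mem_ball_zero_iff.1 hs.2).le
      dsimp only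
      split_ifs with hi
      · exact hB i s (by simpa using hsR)
      · exact hle i hi s hs.1 hsR
  refine ⟨fun s => ∑' i, F i s, ?_, ?_⟩
  · intro s hs
    obtain ⟨u, hu, hle⟩ := hbound (‖s‖ + 1) (by positivity)
    have hopen : IsOpen (U ∩ Metric.ball 0 (‖s‖ + 1)) := hU.inter Metric.isOpen_ball
    exact ((Complex.differentiableOn_tsum_of_summable_norm hu (fun i => (hF i).differentiableOn)
      hopen hle).differentiableAt (hopen.mem_nhds ⟨hs, by simp⟩)).differentiableWithinAt
  · intro s hs
    obtain ⟨u, hu, hle⟩ := hbound (‖s‖ + 1) (by positivity)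
    exact (Summable.of_norm_bounded hu fun i => hle i s ⟨hs, by simp⟩).hasSum

lemma det_entries (γ : SL(2, ℤ)) : γ 0 0 * γ 1 1 - γ 0 1 * γ 1 0 = 1 := by
  have h1 := Matrix.det_fin_two γ.1
  rw [γ.2] at h1
  exact h1.symm

lemma mu_neg_eq (γ : SL(2, ℤ)) (z v : ℂ) :
    mu γ z (-v) = (γ 0 0 * z + γ 0 1) - v * (γ 1 0 * z + γ 1 1) := by
  unfold mu
  ring

lemma intCast_mul_add_ne_zero {z : ℂ} (hz : 0 < z.im) (γ : SL(2, ℤ)) :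
    (γ 1 0 : ℂ) * z + γ 1 1 ≠ 0 := by
  intro h
  have him := congrArg Complex.im h
  have hre := congrArg Complex.re h
  simp [hz.ne'] at him
  simp [him] at hre
  have := det_entries γ
  simp [him, hre] at this

/-- A zero would mean `γ z₁ = z₂`, excluded by hypothesis, or `γ z₁ = conj z₂`, which lies in the
lower half-plane. Hence each summand is entire in `s`. -/
lemma mu_ne_zero {N : ℕ} {z₁ z₂ : ℍ}
    (hz : ∀ γ ∈ CongruenceSubgroup.Gamma0 N, γ • z₁ ≠ z₂) {γ : SL(2, ℤ)}
    (hγ : γ ∈ CongruenceSubgroup.Gamma0 N) :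
    mu γ z₁ (-z₂) ≠ 0 ∧ mu γ z₁ (-conj (z₂ : ℂ)) ≠ 0 := by
  have hden := intCast_mul_add_ne_zero z₁.im_pos γ
  have hsmul : ((γ • z₁ : ℍ) : ℂ) = (γ 0 0 * z₁ + γ 0 1) / (γ 1 0 * z₁ + γ 1 1) := by
    rw [UpperHalfPlane.specialLinearGroup_apply]
    simp
  have key {v : ℂ} (h : mu γ z₁ (-v) = 0) : ((γ • z₁ : ℍ) : ℂ) = v := by
    rw [mu_neg_eq, sub_eq_zero] at h
    rw [hsmul, h, mul_div_cancel_right₀ _ hden]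
  refine ⟨fun h => hz γ hγ (UpperHalfPlane.ext (key h)), fun h => ?_⟩
  have him := congrArg Complex.im (key h)
  have h1 := (γ • z₁ : ℍ).im_pos
  have h2 := z₂.im_pos
  rw [Complex.conj_im] at him
  simp only [UpperHalfPlane.coe_im] at him
  linarith

lemma mu_eq_mul_one_sub {z v : ℂ} {γ : SL(2, ℤ)} (hc : γ 1 0 ≠ 0)
    (hne : ((γ 0 0 : ℂ) - γ 1 0 * v) * (γ 1 0 * z + γ 1 1) ≠ 0) :
    mu γ z (-v) = ((γ 0 0 : ℂ) - γ 1 0 * v) * (γ 1 0 * z + γ 1 1) / γ 1 0 *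
      (1 - (((γ 0 0 : ℂ) - γ 1 0 * v) * (γ 1 0 * z + γ 1 1))⁻¹) := by
  have hc' : (γ 1 0 : ℂ) ≠ 0 := by exact_mod_cast hc
  have hdet : (γ 0 0 : ℂ) * γ 1 1 - γ 0 1 * γ 1 0 = 1 := by exact_mod_cast det_entries γ
  rw [div_mul_eq_mul_div, mul_sub, mul_inv_cancel₀ hne, mul_one, eq_div_iff hc', mu_neg_eq]
  linear_combination -hdet

lemma im_mul_abs_le_norm_add (z : ℂ) (c d : ℤ) : z.im * |(c : ℝ)| ≤ ‖(c : ℂ) * z + d‖ := by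
  refine le_trans ?_ (Complex.abs_im_le_norm _)
  simp [abs_mul]
  rw [mul_comm]
  gcongr
  exact le_abs_self _

lemma im_mul_abs_le_norm_sub (w : ℂ) (c a : ℤ) : w.im * |(c : ℝ)| ≤ ‖(a : ℂ) - c * w‖ := by
  have := im_mul_abs_le_norm_add w c (-a)
  rwa [← norm_neg, show -((c : ℂ) * w + ((-a : ℤ) : ℂ)) = (a : ℂ) - c * w by push_cast; ring]
    at this

lemma norm_sub_conj (w : ℂ) (c a : ℤ) : ‖(a : ℂ) - c * conj w‖ = ‖(a : ℂ) - c * w‖ := by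
  rw [← Complex.norm_conj]
  simp

/-- As `|c| ≥ 1`, each factor is at least an imaginary part, so a bounded product bounds both
factors. This bounds `c`, `a` and `d`, which determine the matrix. -/
lemma finite_small_product {N : ℕ} {z w : ℂ} (hz : 0 < z.im) (hw : 0 < w.im) (T : ℝ) :
    {γ : bigCell N | ‖(((γ : CongruenceSubgroup.Gamma0 N) : SL(2, ℤ)) 0 0 : ℂ) -
      (((γ : CongruenceSubgroup.Gamma0 N) : SL(2, ℤ)) 1 0 : ℂ) * w‖ *
      ‖(((γ : CongruenceSubgroup.Gamma0 N) : SL(2, ℤ)) 1 0 : ℂ) * z +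
        (((γ : CongruenceSubgroup.Gamma0 N) : SL(2, ℤ)) 1 1 : ℂ)‖ < T}.Finite := by
  set P := T / z.im
  set Q := T / w.im
  set e : bigCell N → ℤ × ℤ × ℤ := fun γ =>
    (((γ : CongruenceSubgroup.Gamma0 N) : SL(2, ℤ)) 1 0,
      ((γ : CongruenceSubgroup.Gamma0 N) : SL(2, ℤ)) 0 0,
      ((γ : CongruenceSubgroup.Gamma0 N) : SL(2, ℤ)) 1 1)
  have hinj : Function.Injective e := by
    rintro ⟨⟨γ, hγ⟩, hc⟩ ⟨⟨δ, hδ⟩, hc'⟩ h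
    simp only [e, Prod.mk.injEq] at h
    exact Subtype.ext (Subtype.ext (SL2_ext_of_ne_zero hc h.1 h.2.1 h.2.2))
  refine Set.Finite.of_finite_image (f := e) ?_ hinj.injOn
  have hfin (r : ℝ) : {n : ℤ | |(n : ℝ)| ≤ r}.Finite := by
    refine (Set.finite_Icc (-⌈r⌉) ⌈r⌉).subset fun n hn => ?_
    have h1 := abs_le.1 (show |(n : ℝ)| ≤ r from hn)
    have h2 := Int.le_ceil r
    constructor
    · exact_mod_cast (show (-(⌈r⌉ : ℝ)) ≤ n by linarith)
    · exact_mod_cast (show (n : ℝ) ≤ ⌈r⌉ by linarith)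
  refine ((hfin (P / w.im)).prod ((hfin (P + P / w.im * ‖w‖)).prod
    (hfin (Q + P / w.im * ‖z‖)))).subset ?_
  rintro _ ⟨⟨⟨γ, hγ⟩, hc⟩, h, rfl⟩
  change γ 1 0 ≠ 0 at hc
  change ‖(γ 0 0 : ℂ) - (γ 1 0 : ℂ) * w‖ * ‖(γ 1 0 : ℂ) * z + (γ 1 1 : ℂ)‖ < T at h
  have hc1 : (1 : ℝ) ≤ |(γ 1 0 : ℝ)| := by exact_mod_cast Int.one_le_abs hc
  have h1 := im_mul_abs_le_norm_add z (γ 1 0) (γ 1 1)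
  have h2 := im_mul_abs_le_norm_sub w (γ 1 0) (γ 0 0)
  have h1' : z.im ≤ ‖(γ 1 0 : ℂ) * z + (γ 1 1 : ℂ)‖ := (le_mul_of_one_le_right hz.le hc1).trans h1
  have h2' : w.im ≤ ‖(γ 0 0 : ℂ) - (γ 1 0 : ℂ) * w‖ := (le_mul_of_one_le_right hw.le hc1).trans h2
  have hA : ‖(γ 0 0 : ℂ) - (γ 1 0 : ℂ) * w‖ ≤ P := by
    rw [le_div_iff₀ hz]
    exact (mul_le_mul_of_nonneg_left h1' (norm_nonneg _)).trans h.le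
  have hD : ‖(γ 1 0 : ℂ) * z + (γ 1 1 : ℂ)‖ ≤ Q := by
    rw [le_div_iff₀ hw, mul_comm]
    exact (mul_le_mul_of_nonneg_right h2' (norm_nonneg _)).trans h.le
  have hC : |(γ 1 0 : ℝ)| ≤ P / w.im := by
    rw [le_div_iff₀ hw, mul_comm]
    exact h2.trans hA
  have hnorm (n : ℤ) : ‖(n : ℂ)‖ = |(n : ℝ)| := Complex.norm_intCast n
  refine ⟨hC, ?_, ?_⟩
  · change |(γ 0 0 : ℝ)| ≤ _
    calc |(γ 0 0 : ℝ)| = ‖((γ 0 0 : ℂ) - (γ 1 0 : ℂ) * w) + (γ 1 0 : ℂ) * w‖ := by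
          rw [sub_add_cancel, hnorm]
      _ ≤ P + P / w.im * ‖w‖ := by
          refine norm_add_le_of_le hA ?_
          rw [norm_mul, hnorm]
          gcongr
  · change |(γ 1 1 : ℝ)| ≤ _
    calc |(γ 1 1 : ℝ)| = ‖((γ 1 0 : ℂ) * z + (γ 1 1 : ℂ)) - (γ 1 0 : ℂ) * z‖ := by
          rw [add_sub_cancel_left, hnorm]
      _ ≤ Q + P / w.im * ‖z‖ := by
          refine (norm_sub_le _ _).trans (add_le_add hD ?_)
          rw [norm_mul, hnorm]
          gcongr

lemma norm_mul_sub_one_le {x y : ℂ} {C e : ℝ} (hx : ‖x - 1‖ ≤ C * e) (hy : ‖y - 1‖ ≤ C * e)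
    (hx' : ‖x‖ ≤ 1 + C) : ‖x * y - 1‖ ≤ (C + (1 + C) * C) * e := by
  calc ‖x * y - 1‖ = ‖(x - 1) + x * (y - 1)‖ := by ring_nf
    _ ≤ C * e + (1 + C) * (C * e) := by
        refine norm_add_le_of_le hx ?_
        rw [norm_mul]
        exact mul_le_mul hx' hy (norm_nonneg _) ((norm_nonneg _).trans hx')
    _ = _ := by ring

/-- The quotient of the two terms is `1 + O(1 / |m|)` with `m = (a - c w)(c z + d)` and `|m| ≥ im w
· im z · c ^ 2`. The leading term has weight 1 because `4 · 7/8 - 2 ≥ 1`; the gain of 2 gives 3,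
beyond the summability threshold 2. -/
lemma exists_norm_cauchyTerm_sub_leadTerm_le {z w : ℂ} (hz : 0 < z.im) (hw : 0 < w.im) {R : ℝ}
    (hR : 0 ≤ R) : ∃ C : ℝ, ∀ γ : SL(2, ℤ), γ 1 0 ≠ 0 →
      2 ≤ ‖(γ 0 0 : ℂ) - γ 1 0 * w‖ * ‖(γ 1 0 : ℂ) * z + γ 1 1‖ → ∀ s : ℂ, 7 / 8 ≤ s.re → ‖s‖ ≤ R →
      ‖cauchyTerm γ z w s - leadTerm γ z w s‖ ≤ C * cellWeight 3 γ := by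
  obtain ⟨A, hA, hlead⟩ := exists_decayingC2_lead hz hw R
  obtain ⟨B, hB, hfac⟩ := exists_norm_heckeFactor_sub_one_le hR
  refine ⟨A ^ 2 * ((B + (1 + B) * B) / (w.im * z.im)), fun γ hc hT s hs hsR => ?_⟩
  obtain ⟨hX, hY⟩ := hlead s hs hsR
  set c : ℝ := ((γ 1 0).natAbs : ℝ)
  have hcabs : |(γ 1 0 : ℝ)| = c := by simp [c, Nat.cast_natAbs]
  have hc0 : 0 < c := by simpa [c, Int.natAbs_pos] using hc
  set m := ((γ 0 0 : ℂ) - γ 1 0 * w) * (γ 1 0 * z + γ 1 1)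
  set m' := ((γ 0 0 : ℂ) - γ 1 0 * conj w) * (γ 1 0 * z + γ 1 1)
  have hm : 2 ≤ ‖m‖ := by rwa [norm_mul]
  have hmm : ‖m'‖ = ‖m‖ := by rw [norm_mul, norm_mul, norm_sub_conj]
  have hm0 : m ≠ 0 := norm_pos_iff.1 (by linarith)
  have hm0' : m' ≠ 0 := norm_pos_iff.1 (by linarith)
  have hε : ‖m⁻¹‖ ≤ 1 / 2 := by
    rw [norm_inv, one_div]
    gcongr
  have hε' : ‖m'⁻¹‖ ≤ 1 / 2 := by
    rw [norm_inv, hmm, ← norm_inv]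
    exact hε
  have hεc : ‖m⁻¹‖ ≤ (w.im * z.im)⁻¹ * c ^ (-2 : ℝ) := by
    rw [Real.rpow_neg hc0.le, ← mul_inv, norm_inv, norm_mul]
    have h1 := im_mul_abs_le_norm_add z (γ 1 0) (γ 1 1)
    have h2 := im_mul_abs_le_norm_sub w (γ 1 0) (γ 0 0)
    rw [hcabs] at h1 h2
    refine inv_anti₀ (by positivity) ?_
    calc w.im * z.im * c ^ (2 : ℝ) = (w.im * c) * (z.im * c) := by
          rw [Real.rpow_two]; ring
      _ ≤ _ := by gcongr
  obtain ⟨f1, f2⟩ := hfac s m⁻¹ hsR hε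
  obtain ⟨f1', -⟩ := hfac s m'⁻¹ hsR hε'
  rw [norm_inv m', hmm, ← norm_inv] at f1'
  have hprod := norm_mul_sub_one_le f1 f1' f2
  have hT' : cauchyTerm γ z w s = leadTerm γ z w s *
      (heckeFactor s (1 - m⁻¹) * heckeFactor s (1 - m'⁻¹)) := by
    rw [cauchyTerm_eq, leadTerm_eq hz hw s hc, mu_eq_mul_one_sub hc hm0,
      mu_eq_mul_one_sub hc hm0', heckeFactor_mul, heckeFactor_mul]
    ring
  rw [hT', ← mul_sub_one, norm_mul]
  have hcw : cellWeight 1 γ * c ^ (-2 : ℝ) = cellWeight 3 γ := by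
    have : c ^ (-3 : ℝ) = c ^ (-1 : ℝ) * c ^ (-2 : ℝ) := by
      rw [← Real.rpow_add hc0]; norm_num
    rw [cellWeight, cellWeight, this]
    ring
  calc _ ≤ (A ^ 2 * cellWeight 1 γ) * ((B + (1 + B) * B) * ((w.im * z.im)⁻¹ * c ^ (-2 : ℝ))) := by
        have := cellWeight_nonneg 1 γ
        gcongr
        · exact norm_leadTerm_le hX hY (by linarith) hc
        · exact hprod.trans (by gcongr)
    _ = A ^ 2 * ((B + (1 + B) * B) / (w.im * z.im)) * (cellWeight 1 γ * c ^ (-2 : ℝ)) := by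
        rw [div_eq_mul_inv]; ring
    _ = _ := by rw [hcw]

lemma differentiable_cauchyTerm {γ : SL(2, ℤ)} {z w : ℂ} (h1 : mu γ z (-w) ≠ 0)
    (h2 : mu γ z (-conj w) ≠ 0) : Differentiable ℂ fun s => cauchyTerm γ z w s := by
  simp_rw [cauchyTerm_eq]
  exact (differentiable_heckeFactor h1).mul (differentiable_heckeFactor h2)

lemma differentiable_leadTerm {γ : SL(2, ℤ)} {z w : ℂ} (hz : 0 < z.im) (hw : 0 < w.im)
    (hc : γ 1 0 ≠ 0) : Differentiable ℂ fun s => leadTerm γ z w s := by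
  unfold leadTerm
  refine Differentiable.mul ?_ ((differentiable_leadX hw _).mul (differentiable_leadY hz _))
  refine Differentiable.const_cpow (by fun_prop) (Or.inl ?_)
  exact_mod_cast Int.natAbs_ne_zero.2 hc

/-- When `c = 0`, `a = d = ±1`, so the matrix is determined by `(a, b)`; the indicator `δ` encodes
the two choices of `a`. -/
lemma summable_decay_compl_bigCell (N : ℕ) : Summable fun γ : ((bigCell N)ᶜ : Set _) =>
    4 * decay (((γ : CongruenceSubgroup.Gamma0 N) : SL(2, ℤ)) 0 1) := by
  set δ : ℤ → ℝ := fun n => if n ∈ ({1, -1} : Finset ℤ) then 1 else 0 with hδ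
  have hδs : Summable δ :=
    summable_of_ne_finset_zero (s := ({1, -1} : Finset ℤ)) fun x hx => if_neg hx
  have hδ0 (n : ℤ) : 0 ≤ δ n := by
    rw [hδ]; dsimp only; split_ifs <;> norm_num
  have h : Summable fun x : ℤ × ℤ => δ x.1 * (4 * decay x.2) :=
    hδs.mul_of_nonneg (summable_decay_int.mul_left 4) hδ0
      fun x => mul_nonneg (by norm_num) (decay_nonneg _)
  have hent (γ : ((bigCell N)ᶜ : Set _)) :
      (((γ : CongruenceSubgroup.Gamma0 N) : SL(2, ℤ)) 1 0 = 0) := not_not.1 γ.2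
  have hmul (γ : ((bigCell N)ᶜ : Set _)) : ((γ : CongruenceSubgroup.Gamma0 N) : SL(2, ℤ)) 0 0 *
      ((γ : CongruenceSubgroup.Gamma0 N) : SL(2, ℤ)) 1 1 = 1 := by
    have := det_entries ((γ : CongruenceSubgroup.Gamma0 N) : SL(2, ℤ))
    rwa [hent, mul_zero, sub_zero] at this
  set e : ((bigCell N)ᶜ : Set _) → ℤ × ℤ := fun γ =>
    (((γ : CongruenceSubgroup.Gamma0 N) : SL(2, ℤ)) 0 0,
      ((γ : CongruenceSubgroup.Gamma0 N) : SL(2, ℤ)) 0 1)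
  have hinj : Function.Injective e := by
    intro γ γ' h
    obtain ⟨h0, h1⟩ := Prod.mk.inj h
    have h2 : ((γ : CongruenceSubgroup.Gamma0 N) : SL(2, ℤ)) 1 1 =
        ((γ' : CongruenceSubgroup.Gamma0 N) : SL(2, ℤ)) 1 1 := by
      have a1 := hmul γ
      rw [h0] at a1
      exact mul_left_cancel₀ (left_ne_zero_of_mul_eq_one (hmul γ')) (a1.trans (hmul γ').symm)
    have h3 := (hent γ).trans (hent γ').symm
    refine Subtype.ext (Subtype.ext ?_)
    ext i j
    fin_cases i <;> fin_cases j <;> assumption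
  refine (h.comp_injective hinj).congr fun γ => ?_
  have : ((γ : CongruenceSubgroup.Gamma0 N) : SL(2, ℤ)) 0 0 ∈ ({1, -1} : Finset ℤ) := by
    rcases Int.eq_one_or_neg_one_of_mul_eq_one (hmul γ) with h | h <;> simp [h]
  have h1 : δ (((γ : CongruenceSubgroup.Gamma0 N) : SL(2, ℤ)) 0 0) = 1 := if_pos this
  exact (congrArg (fun t => t * _) h1).trans (one_mul _)

end Assembly

/-! ### The terms with `c = 0`, and the conclusion. -/

section Main

/-- For large `|b|` both values of `μ_γ` are at least `(1 + |b|) / 2 ≥ 1` in modulus, and `1 - 2 re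
s ≤ -3/4`; the two factors together give the exponent `-3/2` of `decay`. -/
lemma norm_cauchyTerm_le_of_lower_left_eq_zero {z w : ℂ} {γ : SL(2, ℤ)} (hc : γ 1 0 = 0)
    (hb : 2 * (‖z‖ + ‖w‖) + 3 ≤ |(γ 0 1 : ℝ)|) {s : ℂ} (hs : 7 / 8 ≤ s.re) :
    ‖cauchyTerm γ z w s‖ ≤ 4 * decay (γ 0 1) := by
  have hdet := det_entries γ
  rw [hc, mul_zero, sub_zero] at hdet
  have hunit {t : ℤ} (ht : t = 1 ∨ t = -1) : ‖(t : ℂ)‖ = 1 := by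
    rcases ht with h | h <;> simp [h]
  have ha := hunit (Int.eq_one_or_neg_one_of_mul_eq_one hdet)
  have hd := hunit (Int.eq_one_or_neg_one_of_mul_eq_one ((mul_comm _ _).trans hdet))
  set b : ℝ := (γ 0 1 : ℝ)
  have hlow {v : ℂ} (hv : ‖v‖ = ‖w‖) : (1 + |b|) / 2 ≤ ‖mu γ z (-v)‖ := by
    have h1 : (γ 0 1 : ℂ) = mu γ z (-v) - (γ 0 0 * z - v * γ 1 1) := by
      rw [mu_neg_eq, hc]
      push_cast
      ring
    have h2 : |b| ≤ ‖mu γ z (-v)‖ + (‖z‖ + ‖w‖) := by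
      have hb' : |b| = ‖(γ 0 1 : ℂ)‖ := (Complex.norm_intCast _).symm
      rw [hb', h1]
      refine (norm_sub_le _ _).trans (add_le_add le_rfl ((norm_sub_le _ _).trans_eq ?_))
      rw [norm_mul, norm_mul, ha, hd, hv, one_mul, mul_one]
    linarith
  have hone : 1 ≤ (1 + |b|) / 2 := by
    have := norm_nonneg z
    have := norm_nonneg w
    linarith
  have hfac {v : ℂ} (hv : ‖v‖ = ‖w‖) :
      ‖heckeFactor s (mu γ z (-v))‖ ≤ ((1 + |b|) / 2) ^ (-(3 / 4) : ℝ) := by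
    have h1 := hlow hv
    have h2 : 1 ≤ ‖mu γ z (-v)‖ := hone.trans h1
    rw [norm_heckeFactor (norm_pos_iff.1 (by linarith))]
    calc ‖mu γ z (-v)‖ ^ (1 - 2 * s.re) ≤ ‖mu γ z (-v)‖ ^ (-(3 / 4) : ℝ) :=
          Real.rpow_le_rpow_of_exponent_le h2 (by linarith)
      _ ≤ _ := Real.rpow_le_rpow_of_nonpos (by linarith) h1 (by norm_num)
  rw [cauchyTerm_eq, norm_mul]
  refine le_trans ?_ (half_rpow_le_decay b)
  calc _ ≤ ((1 + |b|) / 2) ^ (-(3 / 4) : ℝ) * ((1 + |b|) / 2) ^ (-(3 / 4) : ℝ) :=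
        mul_le_mul (hfac rfl) (hfac (Complex.norm_conj w)) (norm_nonneg _) (by positivity)
    _ = _ := by
        rw [← Real.rpow_add (by linarith)]
        norm_num

lemma lt_of_decay_lt {x y : ℝ} (hy : 0 ≤ y) (h : decay x < decay y) : y < |x| := by
  by_contra! hle
  refine h.not_ge (Real.rpow_le_rpow_of_nonpos (by positivity) ?_ (by norm_num))
  rw [abs_of_nonneg hy]
  linarith

/-- The half-plane on which the series is continued. -/
def continuationDomain : Set ℂ := {s | 95 / 96 < s.re}

lemma isOpen_continuationDomain : IsOpen continuationDomain :=
  isOpen_lt continuous_const Complex.continuous_re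

lemma le_re_of_mem_continuationDomain {s : ℂ} (hs : s ∈ continuationDomain) : 7 / 8 ≤ s.re := by
  have : 95 / 96 < s.re := hs
  linarith

lemma exists_differentiableOn_hasSum_compl_bigCell {N : ℕ} {z w : ℂ}
    (hT : ∀ γ : CongruenceSubgroup.Gamma0 N, Differentiable ℂ (cauchyTerm (γ : SL(2, ℤ)) z w)) :
    ∃ A : ℂ → ℂ, DifferentiableOn ℂ A continuationDomain ∧ ∀ s ∈ continuationDomain,
      HasSum (fun γ : ((bigCell N)ᶜ : Set (CongruenceSubgroup.Gamma0 N)) =>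
        cauchyTerm (γ : CongruenceSubgroup.Gamma0 N) z w s) (A s) := by
  refine exists_differentiableOn_hasSum_of_bounded_off_finite isOpen_continuationDomain
    (fun γ => hT γ) fun R _ => ?_
  set K := 2 * (‖z‖ + ‖w‖) + 3 with hK
  have hK0 : 0 ≤ K := by positivity
  have hsum := summable_decay_compl_bigCell N
  have hpos : 0 < 4 * decay K := mul_pos four_pos (decay_pos K)
  -- Terms of a summable family tend to zero, so only finitely many matrices fail the largeness
  -- condition on `|b|`.
  have hev := hsum.tendsto_cofinite_zero.eventually (gt_mem_nhds hpos)
  refine ⟨_, {γ | ¬ 4 * decay (((γ : CongruenceSubgroup.Gamma0 N) : SL(2, ℤ)) 0 1) < 4 * decay K},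
    hsum, hev, fun γ hγ s hs _ => ?_⟩
  have hlt := lt_of_mul_lt_mul_left (not_not.1 hγ) four_pos.le
  exact norm_cauchyTerm_le_of_lower_left_eq_zero (not_not.1 γ.2) (lt_of_decay_lt hK0 hlt).le
    (le_re_of_mem_continuationDomain hs)

lemma exists_differentiableOn_hasSum_bigCell_sub {N : ℕ} {z w : ℂ} (hz : 0 < z.im) (hw : 0 < w.im)
    (hT : ∀ γ : CongruenceSubgroup.Gamma0 N, Differentiable ℂ (cauchyTerm (γ : SL(2, ℤ)) z w)) :
    ∃ D : ℂ → ℂ, DifferentiableOn ℂ D continuationDomain ∧ ∀ s ∈ continuationDomain,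
      HasSum (fun γ : bigCell N => cauchyTerm (γ : CongruenceSubgroup.Gamma0 N) z w s -
        leadTerm (γ : CongruenceSubgroup.Gamma0 N) z w s) (D s) := by
  refine exists_differentiableOn_hasSum_of_bounded_off_finite isOpen_continuationDomain
    (fun γ => (hT γ).sub (differentiable_leadTerm hz hw γ.2)) fun R hR => ?_
  obtain ⟨C, hC⟩ := exists_norm_cauchyTerm_sub_leadTerm_le hz hw hR
  refine ⟨_, _, (summable_cellWeight (N := N) (ρ := 3) (by norm_num)).mul_left C,
    finite_small_product hz hw 2, fun γ hγ s hs hsR => ?_⟩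
  exact hC _ γ.2 (not_lt.1 hγ) s (le_re_of_mem_continuationDomain hs) hsR

theorem mainTheorem4 (N : ℕ) (hN : 1 ≤ N) (z₁ z₂ : ℍ)
    (hz : ∀ γ ∈ CongruenceSubgroup.Gamma0 N, γ • z₁ ≠ z₂) :
    (∀ s : ℂ, 1 < s.re →
      Summable fun γ : CongruenceSubgroup.Gamma0 N =>
        cauchyTerm (γ : SL(2, ℤ)) (z₁ : ℂ) (z₂ : ℂ) s) ∧
    ∃ (U : Set ℂ) (F : ℂ → ℂ),
      IsOpen U ∧ IsConnected U ∧ {s : ℂ | 1 < s.re} ⊆ U ∧ (1 : ℂ) ∈ U ∧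
      AnalyticOnNhd ℂ F U ∧
      ∀ s : ℂ, 1 < s.re → F s = cauchyKernel N (z₁ : ℂ) (z₂ : ℂ) s := by
  have hz₁ : 0 < (z₁ : ℂ).im := z₁.im_pos
  have hz₂ : 0 < (z₂ : ℂ).im := z₂.im_pos
  have hsub : {s : ℂ | 1 < s.re} ⊆ continuationDomain := fun s hs => by
    have : 1 < s.re := hs
    change 95 / 96 < s.re
    linarith
  have h1U : (1 : ℂ) ∈ continuationDomain := by
    change 95 / 96 < (1 : ℂ).re
    norm_num
  have hT (γ : CongruenceSubgroup.Gamma0 N) :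
      Differentiable ℂ fun s => cauchyTerm (γ : SL(2, ℤ)) (z₁ : ℂ) (z₂ : ℂ) s :=
    differentiable_cauchyTerm (mu_ne_zero hz γ.2).1 (mu_ne_zero hz γ.2).2
  obtain ⟨A, hAd, hAs⟩ := exists_differentiableOn_hasSum_compl_bigCell hT
  obtain ⟨D, hDd, hDs⟩ := exists_differentiableOn_hasSum_bigCell_sub hz₁ hz₂ hT
  obtain ⟨M, hMd, hMs⟩ := exists_continuation_unitPairSum (N := N) (by omega) hz₁ hz₂
  have hbig (s : ℂ) (hs : 1 < s.re) : HasSum (fun γ : bigCell N =>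
      cauchyTerm (γ : CongruenceSubgroup.Gamma0 N) (z₁ : ℂ) (z₂ : ℂ) s) (D s + 2 * M s) := by
    have := (hDs s (hsub hs)).add (hasSum_leadTerm hz₁ hz₂ hs (hMs s hs))
    simpa only [sub_add_cancel] using this
  have hall (s : ℂ) (hs : 1 < s.re) : HasSum (fun γ : CongruenceSubgroup.Gamma0 N =>
      cauchyTerm (γ : SL(2, ℤ)) (z₁ : ℂ) (z₂ : ℂ) s) (D s + 2 * M s + A s) :=
    (hbig s hs).add_compl (hAs s (hsub hs))
  refine ⟨fun s hs => (hall s hs).summable, continuationDomain,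
    fun s => 1 / 2 * (D s + 2 * M s + A s), isOpen_continuationDomain, ?_, hsub, h1U, ?_,
    fun s hs => ?_⟩
  · exact ⟨⟨1, h1U⟩, (convex_halfSpace_re_gt _).isPreconnected⟩
  · exact (((hDd.add (hMd.const_mul 2)).add hAd).const_mul (1 / 2)).analyticOnNhd
      isOpen_continuationDomain
  · rw [cauchyKernel, (hall s hs).tsum_eq]

end Main
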